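/- Let $n\ge 3$ and $N\ge 2$. Put $2^*=\frac{2n}{n-2}$ and let $$W^{1;2^*,2}(\mathbb R^n,\mathbb R^N)=\{u\in L^{2^*}(\mathbb R^n,\mathbb R^N): \mathrm Du\in L^2(\mathbb R^n,\mathbb R^{N\times n})\},\qquad \|u\|_{W}=\|u\|_{L^{2^*}(\mathbb R^n)}+\|\mathrm Du\|_{L^2(\mathbb R^n)},$$ where $\mathrm Du$ is the weak gradient; functions are identified when they agree almost everywhere. Let $F:\mathbb R^n\times\mathbb R^{N\times n}\to\mathbb R^N$ be a Carathéodory map: $F(\cdot,X)$ is measurable for every $X$, and $F(x,\cdot)$ is continuous for a.e. $x$. Assume that $F$ satisfies the following AK-condition: there are - a linear map $\mathbf A:\mathbb R^{N\times n}\to\mathbb R^N$ that is elliptic, i.e. $|\mathbf A:\xi\otimes a|>0$ for all $\xi\in\mathbb R^N\setminus\{0\}$, $a\in\mathbb R^n\setminus\{0\}$ (equivalently, $|\mathbf A:\xi\otimes a|\ge\nu|\xi||a|$ for all $\xi,a$ and some $\nu>0$), with ellipticity constant $\nu(\mathbf A)=\min_{|\eta|=|a|=1}|\mathbf A:\eta\otimes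 a|$, - a positive function $\alpha$ on $\mathbb R^n$ with $\alpha,1/\alpha\in L^\infty(\mathbb R^n)$, and - constants $\beta,\gamma>0$ with $\beta+\gamma<1$, such that for a.e. $x\in\mathbb R^n$ and all $X,Y\in\mathbb R^{N\times n}$ $$\Big|\alpha(x)\big[F(x,X+Y)-F(x,Y)\big]-\mathbf A:X\Big|\le\beta\,\nu(\mathbf A)\,|X|+\gamma\,|\mathbf A:X|.$$ Here $|\cdot|$ denotes Euclidean norms. Then: (1) There is a constant $C>0$ depending only on $F$ such that for all $u,v\in W^{1;2^*,2}(\mathbb R^n,\mathbb R^N)$ the map $F(\cdot,\mathrm Dv)-F(\cdot,\mathrm Du)$ belongs to $L^2(\mathbb R^n,\mathbb R^N)$ and $$\|v-u\|_W\le C\,\|F(\cdot,\mathrm Dv)-F(\cdot,\mathrm Du)\|_{L^2(\mathbb R^n)}.$$ In particular, for every $f:\mathbb R^n\to\mathbb R^N$ the system $F(\cdot,\mathrm Du)=f$ a.e. on $\mathbb R^n$ has at most one solution $u\in W^{1;2^*,2}(\mathbb R^n,\mathbb R^N)$. (2) Suppose moreover that $F(x,0)=0$ for a.e. $x\in\mathbb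 R^n$. Then there is a constant $C>0$ depending only on $F$ such that for every $f\in L^2(\mathbb R^n,\mathbb R^N)$ the system $F(\cdot,\mathrm Du)=f$ a.e. on $\mathbb R^n$ has a unique solution $u\in W^{1;2^*,2}(\mathbb R^n,\mathbb R^N)$, and $\|u\|_W\le C\,\|f\|_{L^2(\mathbb R^n)}$. -/

import Mathlib

open MeasureTheory
open scoped ENNReal ContDiff

noncomputable section

namespace FirstOrderSystem

/-- `ℝⁿ` with its Euclidean norm. -/
abbrev Vec (n : ℕ) : Type := EuclideanSpace ℝ (Fin n)

/-- `ℝ^{N×n}` with its Euclidean (Frobenius) norm; the entry of `X` in row `a` and column `i`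
is `X (a, i)`. -/
abbrev Mat (N n : ℕ) : Type := EuclideanSpace ℝ (Fin N × Fin n)

/-- The rank-one matrix `ξ ⊗ a`, with entries `ξ_b a_j`. -/
def tensor {N n : ℕ} (ξ : Vec N) (a : Vec n) : Mat N n :=
  WithLp.toLp 2 fun p => ξ p.1 * a p.2

/-- Ellipticity of a linear map `A : ℝ^{N×n} → ℝᴺ`: its kernel contains no rank-one direction.
By compactness of the unit spheres this is the same as `|A : ξ ⊗ a| ≥ ν |ξ| |a|` for some
`ν > 0`. -/
def IsElliptic {N n : ℕ} (A : Mat N n →ₗ[ℝ] Vec N) : Prop :=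
  ∀ (ξ : Vec N) (a : Vec n), ξ ≠ 0 → a ≠ 0 → 0 < ‖A (tensor ξ a)‖

/-- The ellipticity constant `ν(A) = min_{|η| = |a| = 1} |A : η ⊗ a|` (for `n, N ≥ 1` the infimum
is over a nonempty set and is attained, by compactness). -/
def ellipticityConst {N n : ℕ} (A : Mat N n →ₗ[ℝ] Vec N) : ℝ :=
  sInf {r : ℝ | ∃ (η : Vec N) (a : Vec n), ‖η‖ = 1 ∧ ‖a‖ = 1 ∧ r = ‖A (tensor η a)‖}

/-- Carathéodory maps: `F(·, X)` is (Lebesgue) measurable for every `X`, and `F(x, ·)` is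
continuous for almost every `x`. -/
structure IsCaratheodory {n N : ℕ} (F : Vec n → Mat N n → Vec N) : Prop where
  aemeasurable : ∀ X : Mat N n, AEMeasurable (fun x => F x X) volume
  ae_continuous : ∀ᵐ x ∂(volume : Measure (Vec n)), Continuous (F x)

/-- The AK-condition of ellipticity of `F` with respect to the linear map `A`. -/
def AKCondition {n N : ℕ} (F : Vec n → Mat N n → Vec N) (A : Mat N n →ₗ[ℝ] Vec N) : Prop :=
  IsElliptic A ∧
  ∃ (α : Vec n → ℝ) (β γ : ℝ),
    (∀ᵐ x ∂(volume : Measure (Vec n)), 0 < α x) ∧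
    MemLp α ∞ volume ∧ MemLp (fun x => 1 / α x) ∞ volume ∧
    0 < β ∧ 0 < γ ∧ β + γ < 1 ∧
    ∀ᵐ x ∂(volume : Measure (Vec n)), ∀ X Y : Mat N n,
      ‖α x • (F x (X + Y) - F x Y) - A X‖ ≤ β * ellipticityConst A * ‖X‖ + γ * ‖A X‖

/-- `G` is the weak gradient of `u : ℝⁿ → ℝᴺ`: both are locally integrable and
`∫ u_a ∂ᵢφ = - ∫ G_{a i} φ` for every test function `φ ∈ C_c^∞(ℝⁿ)` and all `a`, `i`. -/
structure IsWeakGradient {n N : ℕ} (u : Vec n → Vec N) (G : Vec n → Mat N n) : Prop where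
  locallyIntegrable : LocallyIntegrable u volume
  locallyIntegrable_grad : LocallyIntegrable G volume
  integral_eq : ∀ φ : Vec n → ℝ, ContDiff ℝ ∞ φ → HasCompactSupport φ →
    ∀ (a : Fin N) (i : Fin n),
      ∫ x, u x a * fderiv ℝ φ x (EuclideanSpace.single i 1) = - ∫ x, G x (a, i) * φ x

/-- The conjugate Sobolev exponent `2* = 2n / (n - 2)`, meant for `n ≥ 3`. -/
def sobolevExp (n : ℕ) : ℝ≥0∞ := ENNReal.ofReal (2 * (n : ℝ) / ((n : ℝ) - 2))

lemma locallyIntegrable_coord {n : ℕ} {ι : Type} [Fintype ι] {u : Vec n → EuclideanSpace ℝ ι}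
    (hu : LocallyIntegrable u volume) (a : ι) : LocallyIntegrable (fun x => u x a) volume := by
  intro x
  obtain ⟨s, hs, h⟩ := hu x
  exact ⟨s, hs, (EuclideanSpace.proj (𝕜 := ℝ) a : EuclideanSpace ℝ ι →L[ℝ] ℝ).integrable_comp h⟩

lemma integrable_coord_mul {n : ℕ} {ι : Type} [Fintype ι] {u : Vec n → EuclideanSpace ℝ ι}
    (hu : LocallyIntegrable u volume) (a : ι) {φ : Vec n → ℝ} (hφ : Continuous φ)
    (hc : HasCompactSupport φ) : Integrable (fun x => u x a * φ x) volume := by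
  simpa [mul_comm] using
    (locallyIntegrable_coord hu a).integrable_smul_left_of_hasCompactSupport hφ hc

lemma continuous_partial {n : ℕ} {φ : Vec n → ℝ} (hφ : ContDiff ℝ ∞ φ) (e : Vec n) :
    Continuous fun x => fderiv ℝ φ x e :=
  (hφ.continuous_fderiv (by simp)).clm_apply continuous_const

lemma hasCompactSupport_partial {n : ℕ} {φ : Vec n → ℝ} (hc : HasCompactSupport φ) (e : Vec n) :
    HasCompactSupport fun x => fderiv ℝ φ x e :=
  hc.fderiv_apply ℝ e

lemma IsWeakGradient.congr {n N : ℕ} {u v : Vec n → Vec N} {G H : Vec n → Mat N n}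
    (h : IsWeakGradient u G) (huv : v =ᵐ[volume] u) (hGH : H =ᵐ[volume] G) :
    IsWeakGradient v H where
  locallyIntegrable := h.locallyIntegrable.congr huv.symm
  locallyIntegrable_grad := h.locallyIntegrable_grad.congr hGH.symm
  integral_eq φ hφ hc a i := by
    rw [integral_congr_ae (g := fun x => u x a * fderiv ℝ φ x (EuclideanSpace.single i 1))
      (by filter_upwards [huv] with x hx; rw [hx]), h.integral_eq φ hφ hc a i,
      integral_congr_ae (f := fun x => H x (a, i) * φ x) (g := fun x => G x (a, i) * φ x)
      (by filter_upwards [hGH] with x hx; rw [hx])]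

lemma IsWeakGradient.zero {n N : ℕ} :
    IsWeakGradient (0 : Vec n → Vec N) (0 : Vec n → Mat N n) where
  locallyIntegrable := (locallyIntegrable_const (0 : Vec N))
  locallyIntegrable_grad := (locallyIntegrable_const (0 : Mat N n))
  integral_eq φ hφ hc a i := by simp

lemma IsWeakGradient.add {n N : ℕ} {u v : Vec n → Vec N} {G H : Vec n → Mat N n}
    (hu : IsWeakGradient u G) (hv : IsWeakGradient v H) : IsWeakGradient (u + v) (G + H) where
  locallyIntegrable := hu.locallyIntegrable.add hv.locallyIntegrable
  locallyIntegrable_grad := hu.locallyIntegrable_grad.add hv.locallyIntegrable_grad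
  integral_eq φ hφ hc a i := by
    have c := continuous_partial hφ (EuclideanSpace.single i 1)
    have k := hasCompactSupport_partial hc (EuclideanSpace.single i 1)
    simp only [Pi.add_apply, PiLp.add_apply, add_mul]
    rw [integral_add (integrable_coord_mul hu.locallyIntegrable a c k)
        (integrable_coord_mul hv.locallyIntegrable a c k),
      integral_add (integrable_coord_mul hu.locallyIntegrable_grad (a, i) hφ.continuous hc)
        (integrable_coord_mul hv.locallyIntegrable_grad (a, i) hφ.continuous hc),
      hu.integral_eq φ hφ hc, hv.integral_eq φ hφ hc]
    ring

lemma IsWeakGradient.smul {n N : ℕ} {u : Vec n → Vec N} {G : Vec n → Mat N n} (c : ℝ)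
    (hu : IsWeakGradient u G) : IsWeakGradient (c • u) (c • G) where
  locallyIntegrable := hu.locallyIntegrable.smul c
  locallyIntegrable_grad := hu.locallyIntegrable_grad.smul c
  integral_eq φ hφ hc a i := by
    simp only [Pi.smul_apply, PiLp.smul_apply, smul_eq_mul, mul_assoc]
    rw [integral_const_mul, integral_const_mul, hu.integral_eq φ hφ hc]
    ring

/-- Weak gradients are unique up to almost everywhere equality. -/
lemma IsWeakGradient.ae_unique {n N : ℕ} {u : Vec n → Vec N} {G H : Vec n → Mat N n}
    (hG : IsWeakGradient u G) (hH : IsWeakGradient u H) : G =ᵐ[volume] H := by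
  have key : ∀ p : Fin N × Fin n, ∀ᵐ x ∂(volume : Measure (Vec n)), G x p = H x p := by
    rintro ⟨a, i⟩
    refine ae_eq_of_integral_contDiff_smul_eq (locallyIntegrable_coord hG.locallyIntegrable_grad _)
      (locallyIntegrable_coord hH.locallyIntegrable_grad _) fun φ hφ hc => ?_
    have h := (hG.integral_eq φ hφ hc a i).symm.trans (hH.integral_eq φ hφ hc a i)
    simpa [mul_comm] using h
  filter_upwards [ae_all_iff.2 key] with x hx
  ext p
  exact hx p

/-- The J.L. Lions space `W^{1;2*,2}(ℝⁿ, ℝᴺ) = {u ∈ L^{2*} : Du ∈ L²}`. -/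
def lionsSpace (n N : ℕ) : Submodule ℝ (Lp (Vec N) (sobolevExp n) (volume : Measure (Vec n))) where
  carrier := {u | ∃ G : Lp (Mat N n) 2 (volume : Measure (Vec n)), IsWeakGradient u G}
  zero_mem' := ⟨0, IsWeakGradient.zero.congr (Lp.coeFn_zero _ _ _) (Lp.coeFn_zero _ _ _)⟩
  add_mem' := by
    rintro u v ⟨G, hG⟩ ⟨H, hH⟩
    exact ⟨G + H, (hG.add hH).congr (Lp.coeFn_add _ _) (Lp.coeFn_add _ _)⟩
  smul_mem' := by
    rintro c u ⟨G, hG⟩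
    exact ⟨c • G, (hG.smul c).congr (Lp.coeFn_smul _ _) (Lp.coeFn_smul _ _)⟩

/-- The weak gradient `Du ∈ L²` of `u ∈ W^{1;2*,2}(ℝⁿ, ℝᴺ)`. -/
def grad {n N : ℕ} (u : lionsSpace n N) : Lp (Mat N n) 2 (volume : Measure (Vec n)) :=
  Classical.choose u.2

lemma grad_spec {n N : ℕ} (u : lionsSpace n N) :
    IsWeakGradient (u : Lp (Vec N) (sobolevExp n) (volume : Measure (Vec n))) (grad u) :=
  Classical.choose_spec u.2

/-- The natural norm `‖u‖_{L^{2*}} + ‖Du‖_{L²}` of the Lions space. -/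
def lionsNorm {n N : ℕ} (u : lionsSpace n N) : ℝ :=
  ‖(u : Lp (Vec N) (sobolevExp n) (volume : Measure (Vec n)))‖ + ‖grad u‖

/-- `u ∈ W^{1;2*,2}(ℝⁿ, ℝᴺ)` is a strong solution of `F(·, Du) = f`, that is, the system holds
almost everywhere on `ℝⁿ`. -/
def IsStrongSolution {n N : ℕ} (F : Vec n → Mat N n → Vec N) (f : Vec n → Vec N)
    (u : lionsSpace n N) : Prop :=
  ∀ᵐ x ∂(volume : Measure (Vec n)), F x (grad u x) = f x

end FirstOrderSystem

end

open FirstOrderSystem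

/-! The proof is Campanato's method of nearness. Everything rests on a sharp linear estimate,
`ellipticityConst_mul_norm_grad_le`: `ν(A) ‖Du‖₂ ≤ ‖A : Du‖₂`. On the Fourier side a gradient is a
rank-one matrix at almost every frequency, where the bound is the definition of `ν(A)`; Plancherel
integrates it. The pointwise AK-condition, whose right side contains `β ν(A) |X|`, then becomes the
`L²` bound `‖α(F(·,Dv) - F(·,Du)) - A : D(v-u)‖ ≤ (β+γ) ‖A : D(v-u)‖`
(`norm_weighted_sub_symbolOp_le`).

Since `β + γ < 1`, this gives both parts. The triangle inequality bounds `‖A : D(v-u)‖` by the `L²`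
norm of `F(·,Dv) - F(·,Du)`; the linear estimate and Sobolev's inequality turn this into a bound of
the full norm. For existence, `A : D` is onto `L²` (`exists_symbolOp_eq`), so a solution is sought
as `u = U g` with `A : D(U g) = g`, and `g` is the fixed point of a contraction of `L²`.

Surjectivity of `A : D` is a closed range argument: the linear estimate makes the range closed, and
a `g` orthogonal to it has its Fourier transform orthogonal to every `A : η ⊗ ξ`. For fixed `ξ ≠ 0`
these vectors fill `ℝᴺ` by ellipticity, so `g = 0`. -/

/-! ### Fourier transform of divergence free `L²` fields. -/

noncomputable section
namespace FirstOrderSystem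
open Filter SchwartzMap Topology FourierTransform

/-- Vanishing of `∑ ∫ ∂ᵢφ gᵢ` on test functions extends to smooth functions of class `H¹`. -/
lemma sum_integral_partial_eq_zero {n : ℕ} {κ : Type*} [Fintype κ] {e : κ → Fin n}
    {g : κ → Lp ℂ 2 (volume : Measure (Vec n))}
    (H : ∀ φ : Vec n → ℝ, ContDiff ℝ ∞ φ → HasCompactSupport φ →
      ∑ i, ∫ x, fderiv ℝ φ x (EuclideanSpace.single (e i) 1) • g i x = 0)
    {φ : Vec n → ℝ} (hφ : ContDiff ℝ ∞ φ) (h0 : MemLp φ 2 volume)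
    (h1 : ∀ i, MemLp (fun x => fderiv ℝ φ x (EuclideanSpace.single (e i) 1)) 2 volume) :
    ∑ i, ∫ x, fderiv ℝ φ x (EuclideanSpace.single (e i) 1) • g i x = 0 := by
  -- Cut-offs `χ_k(x) = b(x / (k+1))`: the dilation factor is at most `1`, so one constant bounds
  -- all their derivatives.
  let b : ContDiffBump (0 : Vec n) := default
  have hb : ContDiff ℝ ∞ b := b.contDiff
  obtain ⟨C, hC⟩ := (hb.continuous_fderiv (by simp)).bounded_above_of_compact_support
    (b.hasCompactSupport.fderiv ℝ)
  have hC0 : 0 ≤ C := (norm_nonneg _).trans (hC 0)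
  let c : ℕ → ℝ := fun k => ((k : ℝ) + 1)⁻¹
  have hc0 : ∀ k, 0 < c k := fun k => by positivity
  have hc1 : ∀ k, c k ≤ 1 := fun k => inv_le_one_of_one_le₀ (by simp)
  let χ : ℕ → Vec n → ℝ := fun k x => b (c k • x)
  have hχ : ∀ k, ContDiff ℝ ∞ (χ k) := fun k => hb.comp (contDiff_const_smul _)
  have hχs : ∀ k, HasCompactSupport (χ k) := fun k =>
    b.hasCompactSupport.comp_homeomorph (Homeomorph.smulOfNeZero (c k) (hc0 k).ne')
  have hfd : ∀ k x, ‖fderiv ℝ (χ k) x‖ ≤ C := by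
    intro k x
    have : fderiv ℝ (χ k) x = c k • fderiv ℝ b (c k • x) := by
      have := fderiv_comp_smul (𝕜 := ℝ) (f := b) (c k) (x := x)
      simpa [χ, Function.comp_def] using this
    rw [this, norm_smul, Real.norm_of_nonneg (hc0 k).le]
    calc c k * _ ≤ 1 * C := by gcongr; exacts [hc1 k, hC _]
      _ = C := one_mul C
  have hχ1 : ∀ k x, |χ k x| ≤ 1 := fun k x => by
    rw [abs_of_nonneg b.nonneg]; exact b.le_one
  -- Near a fixed point `χ_k` is eventually identically `1`, so the derivative of `χ_k φ` there is
  -- eventually that of `φ`.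
  have hev : ∀ x, ∀ᶠ k in atTop, χ k =ᶠ[𝓝 x] fun _ => 1 := by
    intro x
    have hlim : Tendsto (fun k : ℕ => c k • x) atTop (𝓝 0) := by
      have := (tendsto_one_div_add_atTop_nhds_zero_nat (𝕜 := ℝ)).smul_const x
      simpa [c] using this
    filter_upwards [hlim.eventually b.eventuallyEq_one.eventually_nhds] with k hk
    have hcont : Tendsto (fun y : Vec n => c k • y) (𝓝 x) (𝓝 (c k • x)) :=
      (continuous_const_smul (c k)).tendsto x
    exact hcont.eventually hk
  have hprod : ∀ k x (v : Vec n), fderiv ℝ (fun y => χ k y * φ y) x v =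
      χ k x * fderiv ℝ φ x v + φ x * fderiv ℝ (χ k) x v := by
    intro k x v
    rw [fderiv_fun_mul ((hχ k).differentiable (by simp) x) (hφ.differentiable (by simp) x)]
    simp
  have hT : ∀ i, Tendsto
      (fun k => ∫ x, fderiv ℝ (fun y => χ k y * φ y) x (EuclideanSpace.single (e i) 1) • g i x) atTop
      (𝓝 (∫ x, fderiv ℝ φ x (EuclideanSpace.single (e i) 1) • g i x)) := by
    intro i
    refine tendsto_integral_of_dominated_convergence
      (fun x => (|fderiv ℝ φ x (EuclideanSpace.single (e i) 1)| + C * |φ x|) * ‖g i x‖) ?_ ?_ ?_ ?_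
    · intro k
      exact (continuous_partial ((hχ k).mul hφ) _).aestronglyMeasurable.smul
        (Lp.aestronglyMeasurable _)
    · have m1 : MemLp (fun x => |fderiv ℝ φ x (EuclideanSpace.single (e i) 1)| + C * |φ x|) 2
          volume := (h1 i).norm.add (h0.norm.const_mul C)
      exact m1.integrable_mul (Lp.memLp (g i)).norm
    · intro k
      refine Eventually.of_forall fun x => ?_
      rw [norm_smul, hprod]
      gcongr
      refine (norm_add_le _ _).trans ?_
      rw [norm_mul, norm_mul]
      simp only [Real.norm_eq_abs]
      gcongr ?_ + ?_
      · exact mul_le_of_le_one_left (abs_nonneg _) (hχ1 k x)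
      · rw [mul_comm]
        gcongr
        have := (fderiv ℝ (χ k) x).le_opNorm (EuclideanSpace.single (e i) 1)
        simp only [Real.norm_eq_abs, PiLp.norm_single, norm_one, mul_one] at this
        simpa using this.trans (hfd k x)
    · refine Eventually.of_forall fun x => ?_
      refine tendsto_const_nhds.congr' ?_
      filter_upwards [hev x] with k hk
      have : (fun y => χ k y * φ y) =ᶠ[𝓝 x] φ := by
        filter_upwards [hk] with y hy
        rw [hy, one_mul]
      rw [this.fderiv_eq]
  have hS := tendsto_finsetSum Finset.univ fun i _ => hT i
  refine tendsto_nhds_unique hS (tendsto_const_nhds.congr fun k => ?_)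
  exact (H _ ((hχ k).mul hφ) (hχs k).mul_right).symm

/-- Schwartz functions are complex valued, so the real statement is applied to the real and
imaginary parts. This generality is needed because the Fourier transform of a test function is
Schwartz but need not have compact support. -/
lemma sum_integral_schwartz_eq_zero {n : ℕ} {κ : Type*} [Fintype κ] {e : κ → Fin n}
    {g : κ → Lp ℂ 2 (volume : Measure (Vec n))}
    (H : ∀ φ : Vec n → ℝ, ContDiff ℝ ∞ φ → HasCompactSupport φ →
      ∑ i, ∫ x, fderiv ℝ φ x (EuclideanSpace.single (e i) 1) • g i x = 0) (ψ : 𝓢(Vec n, ℂ)) :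
    ∑ i, ∫ x, (LineDeriv.lineDerivOp (EuclideanSpace.single (e i) 1 : Vec n) ψ) x • g i x = 0 := by
  have hd : Differentiable ℝ ψ := ψ.differentiable
  have hm : ∀ i, MemLp (LineDeriv.lineDerivOp (EuclideanSpace.single (e i) 1 : Vec n) ψ) 2
    (volume : Measure (Vec n)) := fun i => SchwartzMap.memLp _ _ _
  have hl : ∀ (L : ℂ →L[ℝ] ℝ) x (v : Vec n), fderiv ℝ (fun y => L (ψ y)) x v =
      L ((LineDeriv.lineDerivOp v ψ) x) := by
    intro L x v
    rw [SchwartzMap.lineDerivOp_apply, (hd x).lineDeriv_eq_fderiv]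
    have := (L.hasFDerivAt.comp x (hd x).hasFDerivAt).fderiv
    simp only [Function.comp_def] at this
    rw [this]; rfl
  have key : ∀ L : ℂ →L[ℝ] ℝ, ∑ i, ∫ x,
      L ((LineDeriv.lineDerivOp (EuclideanSpace.single (e i) 1 : Vec n) ψ) x) • g i x = 0 := by
    intro L
    have := sum_integral_partial_eq_zero H (φ := fun y => L (ψ y)) (L.contDiff.comp ψ.smooth')
      (L.comp_memLp' (SchwartzMap.memLp ψ 2 volume)) (fun i => by
        simp only [hl]; exact L.comp_memLp' (hm i))
    simpa only [hl] using this
  have hint : ∀ (L : ℂ →L[ℝ] ℝ) i, Integrable (fun x =>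
      L ((LineDeriv.lineDerivOp (EuclideanSpace.single (e i) 1 : Vec n) ψ) x) • g i x) volume :=
    fun L i => memLp_one_iff_integrable.1 ((Lp.memLp (g i)).smul (L.comp_memLp' (hm i)))
  have hsplit : ∀ i, ∫ x, (LineDeriv.lineDerivOp (EuclideanSpace.single (e i) 1 : Vec n) ψ) x • g i x =
      (∫ x, Complex.reCLM
        ((LineDeriv.lineDerivOp (EuclideanSpace.single (e i) 1 : Vec n) ψ) x) • g i x) +
      Complex.I * ∫ x, Complex.imCLM
        ((LineDeriv.lineDerivOp (EuclideanSpace.single (e i) 1 : Vec n) ψ) x) • g i x := by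
    intro i
    rw [← integral_const_mul, ← integral_add (hint _ i) ((hint _ i).const_mul _)]
    congr 1 with x
    simp only [Complex.reCLM_apply, Complex.imCLM_apply, Complex.real_smul, smul_eq_mul]
    conv_lhs => rw [← Complex.re_add_im
      ((LineDeriv.lineDerivOp (EuclideanSpace.single (e i) 1 : Vec n) ψ) x)]
    ring
  simp only [hsplit, Finset.sum_add_distrib, ← Finset.mul_sum, key, mul_zero, add_zero]

/-- The transform on `L²` agrees with the one on tempered distributions, which is defined by
duality. -/
lemma integral_fourier_smul_Lp {n : ℕ} (g : Lp ℂ 2 (volume : Measure (Vec n)))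
    (ψ : 𝓢(Vec n, ℂ)) : ∫ x, (𝓕 ψ) x • g x = ∫ x, ψ x • (𝓕 g : Lp ℂ 2 (volume : Measure (Vec n))) x := by
  have h := congrArg (fun T => T ψ) (Lp.fourier_toTemperedDistribution_eq g)
  simpa only [TemperedDistribution.fourier_apply, Lp.toTemperedDistribution_apply] using h

/-- The Fourier transform of a divergence free `L²` field is pointwise orthogonal to `ξ`. -/
theorem sum_smul_fourier_eq_zero {n : ℕ} {κ : Type*} [Fintype κ] {e : κ → Fin n}
    {g : κ → Lp ℂ 2 (volume : Measure (Vec n))}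
    (H : ∀ φ : Vec n → ℝ, ContDiff ℝ ∞ φ → HasCompactSupport φ →
      ∑ i, ∫ x, fderiv ℝ φ x (EuclideanSpace.single (e i) 1) • g i x = 0) :
    ∀ᵐ ξ ∂(volume : Measure (Vec n)),
      ∑ i, ξ (e i) • (𝓕 (g i) : Lp ℂ 2 (volume : Measure (Vec n))) ξ = 0 := by
  have hloc : ∀ i, LocallyIntegrable
      (fun ξ : Vec n => ξ (e i) •
        (𝓕 (g i) : Lp ℂ 2 (volume : Measure (Vec n))) ξ) volume := fun i =>
    ((Lp.memLp (𝓕 (g i))).locallyIntegrable (by norm_num)).continuous_smul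
      (by fun_prop)
  refine ae_eq_zero_of_integral_contDiff_smul_eq_zero
    (locallyIntegrable_finsetSum _ fun i _ => hloc i) fun ψ hψ hψs => ?_
  have hcs : HasCompactSupport (fun x => (ψ x : ℂ)) := hψs.comp_left (g := Complex.ofReal) rfl
  let ψc : 𝓢(Vec n, ℂ) := hcs.toSchwartzMap (Complex.ofRealCLM.contDiff.comp hψ)
  have hψc : ∀ x, ψc x = (ψ x : ℂ) := fun x => rfl
  -- Differentiating `𝓕 ψ` multiplies `ψ` by `-2πi ξ` under the transform; duality then moves `𝓕`
  -- onto `g`.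
  have h := sum_integral_schwartz_eq_zero H (𝓕 ψc)
  have htg : ∀ i, Function.HasTemperateGrowth
      (fun x : Vec n => inner ℝ x (EuclideanSpace.single (e i) 1)) := fun i => by fun_prop
  have hterm : ∀ i, ∫ x, (LineDeriv.lineDerivOp (EuclideanSpace.single (e i) 1 : Vec n) (𝓕 ψc)) x • g i x
      = (-(2 * Real.pi * Complex.I)) *
        ∫ x, ψ x • x (e i) • (𝓕 (g i) : Lp ℂ 2 (volume : Measure (Vec n))) x := by
    intro i
    rw [SchwartzMap.lineDerivOp_fourier_eq, integral_fourier_smul_Lp, ← integral_const_mul]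
    congr 1 with x
    rw [_root_.smul_apply, SchwartzMap.smulLeftCLM_apply (htg i)]
    simp only [hψc, EuclideanSpace.inner_single_right, Complex.real_smul, smul_eq_mul]
    simp
    ring
  simp only [hterm, ← Finset.mul_sum] at h
  simp only [Finset.smul_sum]
  rw [integral_finsetSum _ fun i _ => (hloc i).integrable_smul_left_of_hasCompactSupport
    hψ.continuous hψs]
  exact (mul_eq_zero.1 h).resolve_left (by simp [Real.pi_ne_zero])

end FirstOrderSystem

end

/-! ### Plancherel's theorem and linear relations for the real and imaginary parts of the transform.
-/

noncomputable section
namespace FirstOrderSystem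
open Filter Topology FourierTransform

/-- The Fourier transform of a coordinate of a real vector valued `L²` function. -/
def coordFourier {n : ℕ} {ι : Type*} [Fintype ι] (p : ι) :
    Lp (EuclideanSpace ℝ ι) 2 (volume : Measure (Vec n)) →L[ℝ]
      Lp ℂ 2 (volume : Measure (Vec n)) :=
  ((Lp.fourierTransformₗᵢ (Vec n) ℂ).toContinuousLinearEquiv.toContinuousLinearMap.restrictScalars
    ℝ).comp ((Complex.ofRealCLM ∘L EuclideanSpace.proj (𝕜 := ℝ) p).compLpL 2 volume)

/-- The real part (`ℓ = Re`) or the imaginary part (`ℓ = Im`) of the Fourier transform. -/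
def fourierPart {n : ℕ} {ι : Type*} [Fintype ι] (ℓ : ℂ →L[ℝ] ℝ)
    (G : Lp (EuclideanSpace ℝ ι) 2 (volume : Measure (Vec n))) (ξ : Vec n) : EuclideanSpace ℝ ι :=
  WithLp.toLp 2 fun p => ℓ (coordFourier p G ξ)

section

variable {n : ℕ} {ι κ : Type*} [Fintype ι] [Fintype κ]

lemma norm_sq_eq_integral {E 𝕜 : Type*} [RCLike 𝕜] [NormedAddCommGroup E] [InnerProductSpace 𝕜 E]
    (f : Lp E 2 (volume : Measure (Vec n))) : ‖f‖ ^ 2 = ∫ x, ‖f x‖ ^ 2 := by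
  rw [← inner_self_eq_norm_sq (𝕜 := 𝕜), L2.inner_def, ← integral_re (L2.integrable_inner f f)]
  simp

lemma integrable_norm_sq {E : Type*} [NormedAddCommGroup E]
    (f : Lp E 2 (volume : Measure (Vec n))) : Integrable (fun x => ‖f x‖ ^ 2) volume :=
  (Lp.memLp f).norm.integrable_sq

lemma coordFourier_apply (p : ι) (G : Lp (EuclideanSpace ℝ ι) 2 (volume : Measure (Vec n))) :
    coordFourier p G =
      𝓕 ((Complex.ofRealCLM ∘L EuclideanSpace.proj (𝕜 := ℝ) p).compLpL 2 volume G) := rfl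

lemma norm_fourierPart_sq (G : Lp (EuclideanSpace ℝ ι) 2 (volume : Measure (Vec n))) (ξ : Vec n) :
    ‖fourierPart Complex.reCLM G ξ‖ ^ 2 + ‖fourierPart Complex.imCLM G ξ‖ ^ 2 =
      ∑ p, ‖coordFourier p G ξ‖ ^ 2 := by
  simp only [EuclideanSpace.norm_sq_eq, ← Finset.sum_add_distrib]
  refine Finset.sum_congr rfl fun p _ => ?_
  rw [← Complex.normSq_eq_norm_sq, Complex.normSq_apply]
  simp [fourierPart, sq]

lemma integrable_norm_fourierPart_sq
    (G : Lp (EuclideanSpace ℝ ι) 2 (volume : Measure (Vec n))) :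
    Integrable (fun ξ => ‖fourierPart Complex.reCLM G ξ‖ ^ 2 +
      ‖fourierPart Complex.imCLM G ξ‖ ^ 2) volume := by
  simp only [norm_fourierPart_sq]
  exact integrable_finsetSum _ fun p _ => integrable_norm_sq _

/-- Plancherel's theorem. -/
lemma norm_sq_eq_integral_fourierPart (G : Lp (EuclideanSpace ℝ ι) 2 (volume : Measure (Vec n))) :
    ‖G‖ ^ 2 = ∫ ξ, (‖fourierPart Complex.reCLM G ξ‖ ^ 2 +
      ‖fourierPart Complex.imCLM G ξ‖ ^ 2) := by
  have h : ∀ p, ∫ ξ, ‖coordFourier p G ξ‖ ^ 2 = ∫ x, ‖G x p‖ ^ 2 := by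
    intro p
    rw [← norm_sq_eq_integral (𝕜 := ℂ), coordFourier_apply, Lp.norm_fourier_eq,
      norm_sq_eq_integral (𝕜 := ℂ)]
    refine integral_congr_ae ?_
    filter_upwards [(Complex.ofRealCLM ∘L EuclideanSpace.proj (𝕜 := ℝ) p).coeFn_compLpL
      (p := 2) G] with x hx
    rw [hx]
    simp
  have hG : ∀ p, Integrable (fun x => ‖G x p‖ ^ 2) volume := fun p =>
    ((EuclideanSpace.proj (𝕜 := ℝ) p).comp_memLp' (Lp.memLp G)).norm.integrable_sq
  simp only [norm_fourierPart_sq]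
  rw [integral_finsetSum _ fun p _ => integrable_norm_sq _, norm_sq_eq_integral (𝕜 := ℝ)]
  simp only [h, EuclideanSpace.norm_sq_eq]
  exact integral_finsetSum _ fun p _ => hG p

/-- The transform acts coordinatewise and `L` has constant real coefficients, so both it and the
real-linear `ℓ` commute with `L`. Working with `ℓ` avoids complexifying `A`. -/
lemma fourierPart_compLpL [DecidableEq ι] (ℓ : ℂ →L[ℝ] ℝ)
    (L : EuclideanSpace ℝ ι →L[ℝ] EuclideanSpace ℝ κ)
    (G : Lp (EuclideanSpace ℝ ι) 2 (volume : Measure (Vec n))) :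
    ∀ᵐ ξ, fourierPart ℓ (L.compLpL 2 volume G) ξ = L (fourierPart ℓ G ξ) := by
  have hL : ∀ (X : EuclideanSpace ℝ ι) b, L X b = ∑ p, L (EuclideanSpace.single p 1) b * X p := by
    intro X b
    conv_lhs => rw [← (EuclideanSpace.basisFun ι ℝ).sum_repr X]
    simp [mul_comm]
  have h1 : ∀ b, coordFourier b (L.compLpL 2 volume G) =
      ∑ p, L (EuclideanSpace.single p 1) b • coordFourier p G := by
    intro b
    simp only [coordFourier, ContinuousLinearMap.comp_apply, ← map_smul, ← map_sum]
    congr 1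
    refine Lp.ext ?_
    have e1 := (Complex.ofRealCLM ∘L EuclideanSpace.proj (𝕜 := ℝ) b).coeFn_compLpL (p := 2)
      (L.compLpL 2 volume G)
    have e2 := L.coeFn_compLpL (p := 2) G
    have e3 := fun p : ι => (Complex.ofRealCLM ∘L EuclideanSpace.proj (𝕜 := ℝ) p).coeFn_compLpL
      (p := 2) (L (EuclideanSpace.single p 1) b • G)
    have e4 := fun p : ι => Lp.coeFn_smul (L (EuclideanSpace.single p 1) b) G
    filter_upwards [e1, e2, ae_all_iff.2 e3, ae_all_iff.2 e4, Lp.coeFn_finsetSum Finset.univ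
      fun p => (Complex.ofRealCLM ∘L EuclideanSpace.proj (𝕜 := ℝ) p).compLpL 2 volume
        (L (EuclideanSpace.single p 1) b • G)] with x h1 h2 h3 h4 h5
    rw [h1, h5]
    simp only [Finset.sum_apply, h3, h4, h2]
    simp [hL (G x) b]
  have e5 := fun b : κ => Lp.coeFn_finsetSum Finset.univ
    fun p => L (EuclideanSpace.single p 1) b • coordFourier p G
  have e6 := fun (b : κ) (p : ι) => Lp.coeFn_smul (L (EuclideanSpace.single p 1) b)
    (coordFourier p G)
  filter_upwards [ae_all_iff.2 e5, ae_all_iff.2 fun b => ae_all_iff.2 (e6 b)] with ξ h5 h6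
  ext b
  rw [hL]
  simp only [fourierPart, h1, h5, Finset.sum_apply, h6, map_sum, Pi.smul_apply, map_smul,
    smul_eq_mul]

/-- The indexed form serves two purposes: the curl relations of a gradient, and orthogonality to all
`A : D(φ e_a)`. -/
lemma sum_mul_fourierPart_eq_zero (ℓ : ℂ →L[ℝ] ℝ)
    (G : Lp (EuclideanSpace ℝ ι) 2 (volume : Measure (Vec n))) (c : κ → ℝ) (e : κ → Fin n)
    (p : κ → ι)
    (H : ∀ φ : Vec n → ℝ, ContDiff ℝ ∞ φ → HasCompactSupport φ →
      ∑ k, c k * ∫ x, fderiv ℝ φ x (EuclideanSpace.single (e k) 1) * G x (p k) = 0) :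
    ∀ᵐ ξ, ∑ k, c k * ξ (e k) * fourierPart ℓ G ξ (p k) = 0 := by
  have h := sum_smul_fourier_eq_zero (e := e) (g := fun k =>
    (Complex.ofRealCLM ∘L EuclideanSpace.proj (𝕜 := ℝ) (p k)).compLpL 2 volume (c k • G)) ?_
  · have e1 := fun k => Lp.coeFn_smul (c k) (coordFourier (p k) G)
    filter_upwards [h, ae_all_iff.2 e1] with ξ hξ h1
    have h2 : ∀ k, (𝓕 ((Complex.ofRealCLM ∘L EuclideanSpace.proj (𝕜 := ℝ) (p k)).compLpL 2 volume
        (c k • G)) : Lp ℂ 2 (volume : Measure (Vec n))) ξ = c k • coordFourier (p k) G ξ := by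
      intro k
      rw [← coordFourier_apply, map_smul, h1, Pi.smul_apply]
    simp only [h2] at hξ
    have := congrArg ℓ hξ
    simp only [map_sum, map_zero, map_smul, smul_eq_mul] at this
    rw [← this]
    refine Finset.sum_congr rfl fun k _ => ?_
    simp only [fourierPart]
    ring
  · intro φ hφ hs
    have := congrArg Complex.ofReal (H φ hφ hs)
    rw [Complex.ofReal_sum, Complex.ofReal_zero] at this
    rw [← this]
    refine Finset.sum_congr rfl fun k _ => ?_
    rw [Complex.ofReal_mul, ← integral_complex_ofReal, ← integral_const_mul]
    refine integral_congr_ae ?_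
    filter_upwards [(Complex.ofRealCLM ∘L EuclideanSpace.proj (𝕜 := ℝ) (p k)).coeFn_compLpL
      (p := 2) (c k • G), Lp.coeFn_smul (c k) G] with x h1 h2
    rw [h1, h2]
    simp
    ring

end

end FirstOrderSystem

end

/-! ### The constant coefficient operator `A : D`: a priori estimate and trivial cokernel. -/

noncomputable section
namespace FirstOrderSystem
open Filter Topology

section

variable {n N : ℕ}

lemma norm_tensor (η : Vec N) (a : Vec n) : ‖tensor η a‖ = ‖η‖ * ‖a‖ := by
  have : ‖tensor η a‖ ^ 2 = (‖η‖ * ‖a‖) ^ 2 := by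
    rw [mul_pow, EuclideanSpace.norm_sq_eq, EuclideanSpace.norm_sq_eq, EuclideanSpace.norm_sq_eq,
      Fintype.sum_prod_type, Finset.sum_mul_sum]
    simp [tensor, mul_pow]
  exact (pow_left_inj₀ (norm_nonneg _) (by positivity) two_ne_zero).1 this

lemma tensor_smul_smul (s t : ℝ) (η : Vec N) (a : Vec n) :
    tensor (s • η) (t • a) = (s * t) • tensor η a := by
  ext p
  simp [tensor]
  ring

lemma ellipticityConst_nonneg (A : Mat N n →ₗ[ℝ] Vec N) : 0 ≤ ellipticityConst A := by
  refine Real.sInf_nonneg ?_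
  rintro r ⟨η, a, -, -, rfl⟩
  exact norm_nonneg _

lemma ellipticityConst_mul_le (A : Mat N n →ₗ[ℝ] Vec N) (η : Vec N) (a : Vec n) :
    ellipticityConst A * ‖tensor η a‖ ≤ ‖A (tensor η a)‖ := by
  rw [norm_tensor]
  rcases eq_or_ne η 0 with rfl | hη
  · simp
  rcases eq_or_ne a 0 with rfl | ha
  · simp
  have h1 := norm_pos_iff.2 hη
  have h2 := norm_pos_iff.2 ha
  have h : ellipticityConst A ≤ ‖A (tensor (‖η‖⁻¹ • η) (‖a‖⁻¹ • a))‖ := by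
    refine csInf_le ⟨0, ?_⟩ ⟨_, _, ?_, ?_, rfl⟩
    · rintro r ⟨η, a, -, -, rfl⟩
      exact norm_nonneg _
    · rw [norm_smul, norm_inv, norm_norm, inv_mul_cancel₀ h1.ne']
    · rw [norm_smul, norm_inv, norm_norm, inv_mul_cancel₀ h2.ne']
  rw [tensor_smul_smul, map_smul, norm_smul, ← mul_inv, norm_inv, norm_mul, norm_norm, norm_norm]
    at h
  rwa [inv_mul_eq_div, le_div_iff₀ (by positivity)] at h

lemma continuous_tensor : Continuous fun q : Vec N × Vec n => tensor q.1 q.2 := by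
  unfold tensor
  fun_prop

lemma IsElliptic.ellipticityConst_pos {A : Mat N n →ₗ[ℝ] Vec N} (hA : IsElliptic A)
    (hn : 0 < n) (hN : 0 < N) : 0 < ellipticityConst A := by
  have hn' : Nontrivial (Vec n) := by
    have := Fin.pos_iff_nonempty.1 hn
    infer_instance
  have hN' : Nontrivial (Vec N) := by
    have := Fin.pos_iff_nonempty.1 hN
    infer_instance
  have hc : IsCompact (Metric.sphere (0 : Vec N) 1 ×ˢ Metric.sphere (0 : Vec n) 1) :=
    (isCompact_sphere _ _).prod (isCompact_sphere _ _)
  have hne : (Metric.sphere (0 : Vec N) 1 ×ˢ Metric.sphere (0 : Vec n) 1).Nonempty :=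
    (NormedSpace.sphere_nonempty.2 zero_le_one).prod (NormedSpace.sphere_nonempty.2 zero_le_one)
  obtain ⟨⟨η, a⟩, hq, hmin⟩ := hc.exists_isMinOn hne
    (f := fun q => ‖A (tensor q.1 q.2)‖)
    ((LinearMap.continuous_of_finiteDimensional A).comp continuous_tensor).norm.continuousOn
  simp only [Set.mem_prod, mem_sphere_zero_iff_norm] at hq
  have h0 : 0 < ‖A (tensor η a)‖ :=
    hA η a (norm_ne_zero_iff.1 (by simp [hq.1])) (norm_ne_zero_iff.1 (by simp [hq.2]))
  refine h0.trans_le (le_csInf ⟨_, η, a, hq.1, hq.2, rfl⟩ ?_)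
  rintro r ⟨η', a', h1, h2, rfl⟩
  exact hmin (a := (η', a')) (by simp [h1, h2])

/-- All rows of `X` are multiples of `ξ`, so `X` is rank one; dividing a column by a nonzero `ξ i`
gives the other factor. -/
lemma ellipticityConst_mul_norm_le_of_parallel (A : Mat N n →ₗ[ℝ] Vec N) {ξ : Vec n} (hξ : ξ ≠ 0)
    {X : Mat N n} (hX : ∀ a i j, ξ i * X (a, j) = ξ j * X (a, i)) :
    ellipticityConst A * ‖X‖ ≤ ‖A X‖ := by
  obtain ⟨i, hi⟩ : ∃ i, ξ i ≠ 0 := by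
    by_contra! h
    exact hξ (by ext i; simpa using h i)
  have : X = tensor (WithLp.toLp 2 fun a => X (a, i) / ξ i) ξ := by
    ext ⟨a, j⟩
    simp only [tensor]
    field_simp
    linarith [hX a i j]
  rw [this]
  exact ellipticityConst_mul_le _ _ _

lemma fderiv_partial_comm {φ : Vec n → ℝ} (hφ : ContDiff ℝ ∞ φ) (v w x : Vec n) :
    fderiv ℝ (fun y => fderiv ℝ φ y v) x w = fderiv ℝ (fun y => fderiv ℝ φ y w) x v := by
  have hd : Differentiable ℝ (fderiv ℝ φ) :=
    (hφ.fderiv_right (m := ∞) (by simp)).differentiable (by simp)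
  have h : ∀ v w, fderiv ℝ (fun y => fderiv ℝ φ y v) x w = fderiv ℝ (fderiv ℝ φ) x w v := by
    intro v w
    rw [fderiv_clm_apply (hd x) (differentiableAt_const v)]
    simp
  rw [h, h]
  exact second_derivative_symmetric (f' := fderiv ℝ φ) (fun y => (hφ.differentiable (by simp) y).hasFDerivAt)
    (hd x).hasFDerivAt w v

lemma contDiff_partial {φ : Vec n → ℝ} (hφ : ContDiff ℝ ∞ φ) (v : Vec n) :
    ContDiff ℝ ∞ fun x => fderiv ℝ φ x v :=
  (hφ.fderiv_right (m := ∞) (by simp)).clm_apply contDiff_const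

/-- The differential operator `u ↦ A : Du`, as a function of the gradient. -/
def symbolOp (A : Mat N n →ₗ[ℝ] Vec N) :
    Lp (Mat N n) 2 (volume : Measure (Vec n)) →L[ℝ] Lp (Vec N) 2 (volume : Measure (Vec n)) :=
  A.toContinuousLinearMap.compLpL 2 volume

lemma symbolOp_ae (A : Mat N n →ₗ[ℝ] Vec N) (G : Lp (Mat N n) 2 (volume : Measure (Vec n))) :
    symbolOp A G =ᵐ[volume] fun x => A (G x) :=
  A.toContinuousLinearMap.coeFn_compLpL G

lemma ae_ne_zero_vec (hn : 0 < n) : ∀ᵐ ξ ∂(volume : Measure (Vec n)), ξ ≠ 0 := by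
  have : Nontrivial (Vec n) := by
    have := Fin.pos_iff_nonempty.1 hn
    infer_instance
  exact Measure.ae_ne volume 0

/-- The a priori estimate for elliptic first order operators with constant coefficients. -/
theorem ellipticityConst_mul_norm_grad_le (hn : 0 < n) (A : Mat N n →ₗ[ℝ] Vec N)
    {u : Vec n → Vec N} {G : Lp (Mat N n) 2 (volume : Measure (Vec n))}
    (h : IsWeakGradient u G) : ellipticityConst A * ‖G‖ ≤ ‖symbolOp A G‖ := by
  have hcurl : ∀ (ℓ : ℂ →L[ℝ] ℝ), ∀ᵐ ξ, ∀ a i j,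
      ξ i * fourierPart ℓ G ξ (a, j) = ξ j * fourierPart ℓ G ξ (a, i) := by
    intro ℓ
    refine ae_all_iff.2 fun a => ae_all_iff.2 fun i => ae_all_iff.2 fun j => ?_
    -- The weak curl condition: `∫ ∂ᵢφ G_{aj}` and `∫ ∂ⱼφ G_{ai}` both equal `-∫ u_a ∂ᵢ∂ⱼφ`.
    have := sum_mul_fourierPart_eq_zero ℓ G ![1, -1] ![i, j] ![(a, j), (a, i)] ?_
    · filter_upwards [this] with ξ hξ
      simp [Fin.sum_univ_two] at hξ
      linarith
    · intro φ hφ hs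
      have e1 := h.integral_eq _ (contDiff_partial hφ (EuclideanSpace.single i 1))
        (hasCompactSupport_partial hs _) a j
      have e2 := h.integral_eq _ (contDiff_partial hφ (EuclideanSpace.single j 1))
        (hasCompactSupport_partial hs _) a i
      simp only [fderiv_partial_comm hφ (EuclideanSpace.single i 1)] at e1
      rw [e1] at e2
      simp only [Fin.sum_univ_two, Matrix.cons_val_zero, Matrix.cons_val_one]
      simp only [mul_comm (fderiv ℝ φ _ _)]
      linarith
  have hν := ellipticityConst_nonneg A
  refine (sq_le_sq₀ (by positivity) (norm_nonneg _)).1 ?_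
  rw [mul_pow, norm_sq_eq_integral_fourierPart, norm_sq_eq_integral_fourierPart,
    ← integral_const_mul]
  refine integral_mono_ae ((integrable_norm_fourierPart_sq G).const_mul _)
    (integrable_norm_fourierPart_sq _) ?_
  filter_upwards [hcurl Complex.reCLM, hcurl Complex.imCLM, ae_ne_zero_vec hn,
    fourierPart_compLpL Complex.reCLM A.toContinuousLinearMap G,
    fourierPart_compLpL Complex.imCLM A.toContinuousLinearMap G] with ξ h1 h2 h0 h3 h4
  rw [symbolOp, h3, h4, mul_add, ← mul_pow, ← mul_pow]
  gcongr
  · exact ellipticityConst_mul_norm_le_of_parallel A h0 h1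
  · exact ellipticityConst_mul_norm_le_of_parallel A h0 h2

/-- Only zero is orthogonal to `A : Dφ` for all test functions `φ`. -/
theorem eq_zero_of_orthogonal_symbolOp (hn : 0 < n) {A : Mat N n →ₗ[ℝ] Vec N} (hA : IsElliptic A)
    (g : Lp (Vec N) 2 (volume : Measure (Vec n)))
    (H : ∀ φ : Vec n → ℝ, ContDiff ℝ ∞ φ → HasCompactSupport φ → ∀ a : Fin N,
      ∑ q : Fin N × Fin n, A (EuclideanSpace.single (a, q.2) 1) q.1 *
        ∫ x, fderiv ℝ φ x (EuclideanSpace.single q.2 1) * g x q.1 = 0) : g = 0 := by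
  have hz : ∀ ℓ : ℂ →L[ℝ] ℝ, ∀ᵐ ξ, fourierPart ℓ g ξ = 0 := by
    intro ℓ
    have hs := fun a => sum_mul_fourierPart_eq_zero ℓ g
      (fun q : Fin N × Fin n => A (EuclideanSpace.single (a, q.2) 1) q.1) Prod.snd Prod.fst
      (fun φ hφ hs => H φ hφ hs a)
    filter_upwards [ae_all_iff.2 hs, ae_ne_zero_vec hn] with ξ hξ h0
    let T : Vec N →ₗ[ℝ] Vec N :=
      { toFun := fun η => A (tensor η ξ)
        map_add' := fun η η' => by
          rw [← map_add]; congr 1; ext p; simp [tensor, add_mul]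
        map_smul' := fun c η => by
          rw [RingHom.id_apply, ← map_smul]; congr 1; ext p; simp [tensor, mul_assoc] }
    have hT : Function.Injective T := by
      refine (injective_iff_map_eq_zero T).2 fun η hη => ?_
      by_contra hne
      exact (hA η ξ hne h0).ne' (norm_eq_zero.2 hη)
    -- The symbol `η ↦ A : η ⊗ ξ` is square: ellipticity gives injectivity, and equal dimensions
    -- give surjectivity.
    have hT' := LinearMap.injective_iff_surjective.1 hT
    have hexp : ∀ η b, T η b =
        ∑ a, ∑ i, η a * (ξ i * A (EuclideanSpace.single (a, i) 1) b) := by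
      intro η b
      have : tensor η ξ = ∑ a, ∑ i, (η a * ξ i) • EuclideanSpace.single (a, i) (1 : ℝ) := by
        rw [← Fintype.sum_prod_type (f := fun q : Fin N × Fin n =>
          (η q.1 * ξ q.2) • EuclideanSpace.single q (1 : ℝ)),
          ← (EuclideanSpace.basisFun (Fin N × Fin n) ℝ).sum_repr (tensor η ξ)]
        simp [tensor]
      change A (tensor η ξ) b = _
      rw [this]
      simp [mul_assoc]
    have horth : ∀ η, inner ℝ (T η) (fourierPart ℓ g ξ) = 0 := by
      intro η
      rw [PiLp.inner_apply]
      simp only [hexp, RCLike.inner_apply, conj_trivial, Finset.mul_sum]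
      rw [Finset.sum_comm]
      refine Finset.sum_eq_zero fun a _ => ?_
      have := hξ a
      rw [Fintype.sum_prod_type] at this
      rw [← mul_zero (η a), ← this, Finset.mul_sum]
      refine Finset.sum_congr rfl fun b _ => ?_
      rw [Finset.mul_sum]
      exact Finset.sum_congr rfl fun i _ => by ring
    obtain ⟨η, hη⟩ := hT' (fourierPart ℓ g ξ)
    have := horth η
    rwa [hη, inner_self_eq_zero] at this
  have hn0 : ‖g‖ ^ 2 = 0 := by
    rw [norm_sq_eq_integral_fourierPart, ← integral_zero (Vec n) ℝ]
    refine integral_congr_ae ?_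
    filter_upwards [hz Complex.reCLM, hz Complex.imCLM] with ξ h1 h2
    simp [h1, h2]
  exact norm_eq_zero.1 (pow_eq_zero_iff two_ne_zero |>.1 hn0)

end

end FirstOrderSystem

end

/-! ### Sobolev's inequality, solvability of `A : Du = f`, and triviality of zero-gradient maps. -/

noncomputable section
namespace FirstOrderSystem
open Filter Topology

section

variable {n N : ℕ}

lemma one_le_sobolevExp (hn : 3 ≤ n) : 1 ≤ sobolevExp n := by
  have h : (3 : ℝ) ≤ n := by exact_mod_cast hn
  rw [sobolevExp, ENNReal.one_le_ofReal, le_div_iff₀ (by linarith)]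
  linarith

lemma sobolevExp_ne_top : sobolevExp n ≠ ⊤ := ENNReal.ofReal_ne_top

/-- The classical gradient of a map `ℝⁿ → ℝᴺ`. -/
def jacobian (φ : Vec n → Vec N) (x : Vec n) : Mat N n :=
  WithLp.toLp 2 fun p => fderiv ℝ φ x (EuclideanSpace.single p.2 1) p.1

lemma fderiv_apply_eq_sum (φ : Vec n → Vec N) (x v : Vec n) (a : Fin N) :
    fderiv ℝ φ x v a = ∑ i, v i * jacobian φ x (a, i) := by
  conv_lhs => rw [← (EuclideanSpace.basisFun (Fin n) ℝ).sum_repr v]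
  simp [jacobian]

lemma norm_fderiv_le_norm_jacobian (φ : Vec n → Vec N) (x : Vec n) :
    ‖fderiv ℝ φ x‖ ≤ ‖jacobian φ x‖ := by
  refine ContinuousLinearMap.opNorm_le_bound _ (norm_nonneg _) fun v => ?_
  refine (sq_le_sq₀ (norm_nonneg _) (by positivity)).1 ?_
  rw [mul_pow, EuclideanSpace.norm_sq_eq, EuclideanSpace.norm_sq_eq, EuclideanSpace.norm_sq_eq,
    Fintype.sum_prod_type, Finset.sum_mul]
  refine Finset.sum_le_sum fun a _ => ?_
  simp only [Real.norm_eq_abs, sq_abs]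
  rw [fderiv_apply_eq_sum, mul_comm]
  exact Finset.sum_mul_sq_le_sq_mul_sq _ _ _

lemma continuous_jacobian {φ : Vec n → Vec N} (hφ : ContDiff ℝ ∞ φ) :
    Continuous (jacobian φ) := by
  have := hφ.continuous_fderiv (by simp)
  unfold jacobian
  fun_prop

lemma hasCompactSupport_jacobian {φ : Vec n → Vec N} (hs : HasCompactSupport φ) :
    HasCompactSupport (jacobian φ) := by
  refine (hs.fderiv ℝ).comp_left (g := fun L : Vec n →L[ℝ] Vec N =>
    (WithLp.toLp 2 fun p => L (EuclideanSpace.single p.2 1) p.1 : Mat N n)) ?_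
  ext p
  simp

lemma isWeakGradient_jacobian {φ : Vec n → Vec N} (hφ : ContDiff ℝ ∞ φ) : IsWeakGradient φ (jacobian φ) where
  locallyIntegrable := hφ.continuous.locallyIntegrable
  locallyIntegrable_grad := (continuous_jacobian hφ).locallyIntegrable
  integral_eq ψ hψ hψs a i := by
    have hc : ContDiff ℝ ∞ fun x => φ x a := (EuclideanSpace.proj (𝕜 := ℝ) a).contDiff.comp hφ
    have hfd : ∀ x, fderiv ℝ (fun y => φ y a) x (EuclideanSpace.single i 1) =
        jacobian φ x (a, i) := by
      intro x
      have h := ((EuclideanSpace.proj (𝕜 := ℝ) a : Vec N →L[ℝ] ℝ).hasFDerivAt.comp x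
        (hφ.differentiable (by simp) x).hasFDerivAt).fderiv
      simp only [Function.comp_def, PiLp.proj_apply] at h
      rw [h]
      rfl
    simp only [← hfd]
    refine integral_mul_fderiv_eq_neg_fderiv_mul_of_integrable ?_ ?_ ?_
      (fun x _ => hc.differentiable (by simp) x) (fun x _ => hψ.differentiable (by simp) x)
    · exact ((continuous_partial hc _).mul hψ.continuous).integrable_of_hasCompactSupport
        hψs.mul_left
    · exact (hc.continuous.mul (continuous_partial hψ _)).integrable_of_hasCompactSupport
        (hasCompactSupport_partial hψs _).mul_left
    · exact (hc.continuous.mul hψ.continuous).integrable_of_hasCompactSupport hψs.mul_left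

/-- The Gagliardo–Nirenberg–Sobolev inequality for test functions. -/
lemma exists_eLpNorm_le_jacobian (N : ℕ) (hn : 3 ≤ n) : ∃ C : NNReal, ∀ φ : Vec n → Vec N,
    ContDiff ℝ ∞ φ → HasCompactSupport φ →
      eLpNorm φ (sobolevExp n) volume ≤ C * eLpNorm (jacobian φ) 2 volume := by
  refine ⟨SNormLESNormFDerivOfEqConst (Vec N) (volume : Measure (Vec n)) 2, fun φ hφ hs => ?_⟩
  have h3 : (3 : ℝ) ≤ n := by exact_mod_cast hn
  have h := eLpNorm_le_eLpNorm_fderiv_of_eq (volume : Measure (Vec n)) (hφ.of_le (by simp)) hs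
    (p := 2) (p' := (2 * (n : ℝ) / ((n : ℝ) - 2)).toNNReal) (by norm_num) (by simp; omega) (by
      rw [Real.coe_toNNReal _ (div_nonneg (by linarith) (by linarith)), finrank_euclideanSpace_fin]
      have : (n : ℝ) - 2 ≠ 0 := by linarith
      push_cast
      field_simp)
  refine h.trans ?_
  rw [ENNReal.coe_ofNat]
  refine mul_le_mul_right ?_ _
  exact eLpNorm_mono fun x => norm_fderiv_le_norm_jacobian φ x

/-- The integral is the Hölder pairing with `ψ`, which lies in the conjugate space because it is
continuous with compact support. -/
lemma continuous_integral_coord_mul {ι : Type} [Fintype ι] {p : ℝ≥0∞} [Fact (1 ≤ p)] (a : ι)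
    {ψ : Vec n → ℝ} (hψ : Continuous ψ) (hs : HasCompactSupport ψ) :
    Continuous fun u : Lp (EuclideanSpace ℝ ι) p (volume : Measure (Vec n)) =>
      ∫ x, u x a * ψ x := by
  have hp : p.HolderConjugate p.conjExponent := .conjExponent Fact.out
  have hq : Fact (1 ≤ p.conjExponent) := ⟨hp.symm.one_le⟩
  have hm : MemLp ψ p.conjExponent (volume : Measure (Vec n)) := hψ.memLp_of_hasCompactSupport hs
  let B : EuclideanSpace ℝ ι →L[ℝ] ℝ →L[ℝ] ℝ :=
    (ContinuousLinearMap.mul ℝ ℝ).comp (EuclideanSpace.proj (𝕜 := ℝ) a)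
  have : ∀ u : Lp (EuclideanSpace ℝ ι) p (volume : Measure (Vec n)), ∫ x, u x a * ψ x =
      B.lpPairing volume p p.conjExponent u (hm.toLp ψ) := by
    intro u
    rw [ContinuousLinearMap.lpPairing_eq_integral]
    refine integral_congr_ae ?_
    filter_upwards [hm.coeFn_toLp] with x hx
    rw [hx]
    rfl
  simp only [this]
  fun_prop

/-- The set is an intersection, over test functions and indices, of solution sets of continuous
equations; local integrability is automatic in `Lp`. -/
lemma isClosed_isWeakGradient {p : ℝ≥0∞} [Fact (1 ≤ p)] :
    IsClosed {q : Lp (Vec N) p (volume : Measure (Vec n)) ×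
      Lp (Mat N n) 2 (volume : Measure (Vec n)) | IsWeakGradient q.1 q.2} := by
  have : {q : Lp (Vec N) p (volume : Measure (Vec n)) ×
      Lp (Mat N n) 2 (volume : Measure (Vec n)) | IsWeakGradient q.1 q.2} =
      ⋂ (φ : Vec n → ℝ) (_ : ContDiff ℝ ∞ φ) (_ : HasCompactSupport φ) (a : Fin N) (i : Fin n),
        {q | ∫ x, q.1 x a * fderiv ℝ φ x (EuclideanSpace.single i 1) =
          - ∫ x, q.2 x (a, i) * φ x} := by
    ext q
    simp only [Set.mem_ofPred_eq, Set.mem_iInter]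
    exact ⟨fun h => h.integral_eq, fun h => ⟨(Lp.memLp q.1).locallyIntegrable Fact.out,
      (Lp.memLp q.2).locallyIntegrable (by norm_num), h⟩⟩
  rw [this]
  refine isClosed_iInter fun φ => isClosed_iInter fun hφ => isClosed_iInter fun hs =>
    isClosed_iInter fun a => isClosed_iInter fun i => isClosed_eq ?_ ?_
  · exact (continuous_integral_coord_mul a (continuous_partial hφ _)
      (hasCompactSupport_partial hs _)).comp continuous_fst
  · exact ((continuous_integral_coord_mul (a, i) hφ.continuous hs).comp continuous_snd).neg

lemma jacobian_add {φ ψ : Vec n → Vec N} (hφ : ContDiff ℝ ∞ φ) (hψ : ContDiff ℝ ∞ ψ) :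
    jacobian (φ + ψ) = jacobian φ + jacobian ψ := by
  ext x p
  simp [jacobian, fderiv_add (hφ.differentiable (by simp) x) (hψ.differentiable (by simp) x)]

lemma jacobian_smul {φ : Vec n → Vec N} (hφ : ContDiff ℝ ∞ φ) (c : ℝ) :
    jacobian (c • φ) = c • jacobian φ := by
  ext x p
  simp [jacobian, fderiv_const_smul (hφ.differentiable (by simp) x)]

/-- The pairs `(φ, Dφ)` with a test function `φ`. -/
def testPairs (n N : ℕ) : Submodule ℝ (Lp (Vec N) (sobolevExp n) (volume : Measure (Vec n)) ×
    Lp (Mat N n) 2 (volume : Measure (Vec n))) where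
  carrier := {q | ∃ φ : Vec n → Vec N, ContDiff ℝ ∞ φ ∧ HasCompactSupport φ ∧
    q.1 =ᵐ[volume] φ ∧ q.2 =ᵐ[volume] jacobian φ}
  zero_mem' := ⟨0, contDiff_const, HasCompactSupport.zero, Lp.coeFn_zero _ _ _, by
    have : jacobian (0 : Vec n → Vec N) = 0 := by
      ext x p
      simp [jacobian]
    rw [this]
    exact Lp.coeFn_zero _ _ _⟩
  add_mem' := by
    rintro q r ⟨φ, h1, h2, h3, h4⟩ ⟨ψ, k1, k2, k3, k4⟩
    refine ⟨φ + ψ, h1.add k1, h2.add k2, (Lp.coeFn_add _ _).trans (h3.add k3), ?_⟩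
    rw [jacobian_add h1 k1]
    exact (Lp.coeFn_add _ _).trans (h4.add k4)
  smul_mem' := by
    rintro c q ⟨φ, h1, h2, h3, h4⟩
    refine ⟨c • φ, contDiff_const.smul h1, h2.smul_left, (Lp.coeFn_smul _ _).trans ?_, ?_⟩
    · filter_upwards [h3] with x hx
      simp [hx]
    · rw [jacobian_smul h1]
      refine (Lp.coeFn_smul _ _).trans ?_
      filter_upwards [h4] with x hx
      simp [hx]

lemma exists_mem_testPairs {φ : Vec n → Vec N} (hφ : ContDiff ℝ ∞ φ) (hs : HasCompactSupport φ) :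
    ∃ q ∈ testPairs n N, q.2 =ᵐ[volume] jacobian φ := by
  have h1 : MemLp φ (sobolevExp n) (volume : Measure (Vec n)) :=
    hφ.continuous.memLp_of_hasCompactSupport hs
  have h2 : MemLp (jacobian φ) 2 (volume : Measure (Vec n)) :=
    (continuous_jacobian hφ).memLp_of_hasCompactSupport (hasCompactSupport_jacobian hs)
  exact ⟨(h1.toLp φ, h2.toLp _), ⟨φ, hφ, hs, h1.coeFn_toLp, h2.coeFn_toLp⟩, h2.coeFn_toLp⟩

/-- Limits of test pairs are weakly differentiable and satisfy the Sobolev inequality. -/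
lemma exists_norm_le_of_mem_closure_testPairs (N : ℕ) (hn : 3 ≤ n) [Fact (1 ≤ sobolevExp n)] :
    ∃ C : NNReal, ∀ q ∈ closure (testPairs n N : Set (Lp (Vec N) (sobolevExp n)
      (volume : Measure (Vec n)) × Lp (Mat N n) 2 (volume : Measure (Vec n)))),
      IsWeakGradient q.1 q.2 ∧ ‖q.1‖ ≤ C * ‖q.2‖ := by
  obtain ⟨C, hC⟩ := exists_eLpNorm_le_jacobian N hn
  refine ⟨C, fun q hq => ?_⟩
  refine closure_minimal (t := {q : Lp (Vec N) (sobolevExp n) (volume : Measure (Vec n)) ×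
    Lp (Mat N n) 2 (volume : Measure (Vec n)) |
      IsWeakGradient q.1 q.2 ∧ ‖q.1‖ ≤ C * ‖q.2‖}) ?_
    (isClosed_isWeakGradient.inter (isClosed_le continuous_fst.norm
      (continuous_const.mul continuous_snd.norm))) hq
  rintro q ⟨φ, h1, h2, h3, h4⟩
  refine ⟨(isWeakGradient_jacobian h1).congr h3 h4, ?_⟩
  have h := hC φ h1 h2
  rw [← eLpNorm_congr_ae h3, ← eLpNorm_congr_ae h4] at h
  rw [Lp.norm_def, Lp.norm_def, ← ENNReal.coe_toReal C, ← ENNReal.toReal_mul]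
  exact ENNReal.toReal_mono (ENNReal.mul_ne_top ENNReal.coe_ne_top (Lp.eLpNorm_ne_top _)) h

lemma inner_symbolOp_jacobian {A : Mat N n →ₗ[ℝ] Vec N} {φ : Vec n → ℝ} (hφ : ContDiff ℝ ∞ φ)
    (hs : HasCompactSupport φ) (a : Fin N) {G : Lp (Mat N n) 2 (volume : Measure (Vec n))}
    (hG : G =ᵐ[volume] jacobian fun x => φ x • EuclideanSpace.single a (1 : ℝ))
    (g : Lp (Vec N) 2 (volume : Measure (Vec n))) :
    inner ℝ (symbolOp A G) g = ∑ q : Fin N × Fin n, A (EuclideanSpace.single (a, q.2) 1) q.1 *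
        ∫ x, fderiv ℝ φ x (EuclideanSpace.single q.2 1) * g x q.1 := by
  have hj : ∀ x, jacobian (fun x => φ x • EuclideanSpace.single a (1 : ℝ)) x =
      ∑ i, fderiv ℝ φ x (EuclideanSpace.single i 1) • EuclideanSpace.single (a, i) (1 : ℝ) := by
    intro x
    ext ⟨b, j⟩
    have := fderiv_smul_const (𝕜 := ℝ) (hφ.differentiable (by simp) x)
      (EuclideanSpace.single a (1 : ℝ))
    by_cases hb : b = a
    · subst hb
      simp [jacobian, this, Finset.sum_apply, Pi.single_apply]
    · simp [jacobian, this, Finset.sum_apply, hb]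
  have hint : ∀ q : Fin N × Fin n, Integrable (fun x =>
      fderiv ℝ φ x (EuclideanSpace.single q.2 1) * g x q.1) volume := by
    intro q
    simp only [mul_comm (fderiv ℝ φ _ _)]
    exact integrable_coord_mul ((Lp.memLp g).locallyIntegrable (by norm_num)) q.1
      (continuous_partial hφ _) (hasCompactSupport_partial hs _)
  rw [L2.inner_def]
  simp only [← integral_const_mul]
  rw [← integral_finsetSum _ fun q _ => (hint q).const_mul _]
  refine integral_congr_ae ?_
  filter_upwards [symbolOp_ae A G, hG] with x h1 h2
  rw [h1, h2, hj, map_sum, PiLp.inner_apply, Fintype.sum_prod_type]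
  refine Finset.sum_congr rfl fun b _ => ?_
  simp only [map_smul, RCLike.inner_apply, conj_trivial, WithLp.ofLp_sum, Finset.sum_apply,
    Finset.mul_sum, PiLp.smul_apply, smul_eq_mul]
  exact Finset.sum_congr rfl fun i _ => by ring

/-- Solvability of the linear system `A : Du = f`. -/
theorem exists_symbolOp_eq (hn : 3 ≤ n) (hN : 0 < N) {A : Mat N n →ₗ[ℝ] Vec N}
    (hA : IsElliptic A) : ∃ C : NNReal, ∀ f : Lp (Vec N) 2 (volume : Measure (Vec n)),
      ∃ (u : Lp (Vec N) (sobolevExp n) (volume : Measure (Vec n)))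
        (G : Lp (Mat N n) 2 (volume : Measure (Vec n))),
        IsWeakGradient u G ∧ symbolOp A G = f ∧ ‖u‖ ≤ C * ‖G‖ := by
  have hn0 : 0 < n := by omega
  have : Fact (1 ≤ sobolevExp n) := ⟨one_le_sobolevExp hn⟩
  obtain ⟨C, hC⟩ := exists_norm_le_of_mem_closure_testPairs N hn
  refine ⟨C, ?_⟩
  have hν := hA.ellipticityConst_pos hn0 hN
  -- Closing the pairs `(φ, Dφ)` in the product gives a complete space on which both Sobolev's
  -- inequality and the a priori estimate hold.
  let V := (testPairs n N).topologicalClosure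
  have hV : ∀ q : V, IsWeakGradient q.1.1 q.1.2 ∧ ‖q.1.1‖ ≤
    C * ‖q.1.2‖ := fun q => hC q.1 q.2
  let Φ : V →L[ℝ] Lp (Vec N) 2 (volume : Measure (Vec n)) :=
    ((symbolOp A).comp (ContinuousLinearMap.snd ℝ _ _)).comp V.subtypeL
  have hΦ : ∀ q : V, Φ q = symbolOp A q.1.2 := fun q => rfl
  have hcomp : CompleteSpace V := (Submodule.isClosed_topologicalClosure _).completeSpace_coe
  -- `C + 1` controls the maximum norm on the product by the gradient; `ν(A)⁻¹` controls the
  -- gradient by `A : Du`.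
  let K : NNReal := (C + 1) * (ellipticityConst A).toNNReal⁻¹
  have hbound : ∀ q : V, ‖q‖ ≤ K * ‖Φ q‖ := by
    intro q
    have h1 := (hV q).2
    have h2 := ellipticityConst_mul_norm_grad_le hn0 A (hV q).1
    have h3 : ‖q.1.2‖ ≤ (ellipticityConst A)⁻¹ * ‖Φ q‖ := by
      rw [inv_mul_eq_div, le_div_iff₀ hν, mul_comm]
      exact h2
    have hC0 : (0 : ℝ) ≤ C := C.2
    have h4 : ‖q‖ ≤ (C + 1) * ‖q.1.2‖ := by
      rw [Submodule.coe_norm, Prod.norm_def]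
      have := norm_nonneg q.1.2
      exact max_le (by linarith) (by nlinarith)
    calc ‖q‖ ≤ (C + 1) * ((ellipticityConst A)⁻¹ * ‖Φ q‖) := h4.trans (by gcongr)
      _ = K * ‖Φ q‖ := by simp [K, Real.coe_toNNReal _ hν.le]; ring
  have hclosed : IsClosed (LinearMap.range Φ.toLinearMap :
      Set (Lp (Vec N) 2 (volume : Measure (Vec n)))) := by
    have := (Φ.antilipschitz_of_bound hbound).isClosed_range Φ.uniformContinuous
    rwa [LinearMap.coe_range]
  -- The range is closed, so it suffices that its orthogonal complement vanishes; testing against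
  -- `D(φ e_a)` already forces this.
  have htop : LinearMap.range Φ.toLinearMap = ⊤ := by
    rw [← hclosed.submodule_topologicalClosure_eq, Submodule.topologicalClosure_eq_top_iff,
      Submodule.eq_bot_iff]
    intro g hg
    refine eq_zero_of_orthogonal_symbolOp hn0 hA g fun φ hφ hs a => ?_
    obtain ⟨q, hq, hqG⟩ := exists_mem_testPairs
      (φ := fun x => φ x • EuclideanSpace.single a (1 : ℝ)) (hφ.smul contDiff_const) hs.smul_right
    rw [← inner_symbolOp_jacobian hφ hs a hqG g]
    exact (Submodule.mem_orthogonal _ _).1 hg _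
      ⟨⟨q, Submodule.le_topologicalClosure _ hq⟩, rfl⟩
  intro f
  obtain ⟨q, hq⟩ : f ∈ LinearMap.range Φ.toLinearMap := htop ▸ Submodule.mem_top
  exact ⟨_, _, (hV q).1, hq, (hV q).2⟩

open scoped Convolution in
/-- A locally integrable function with vanishing weak derivatives is constant. -/
lemma exists_ae_eq_const_of_integral_partial_eq_zero {h : Vec n → ℝ}
    (hloc : LocallyIntegrable h volume)
    (H : ∀ φ : Vec n → ℝ, ContDiff ℝ ∞ φ → HasCompactSupport φ → ∀ i : Fin n,
      ∫ x, h x * fderiv ℝ φ x (EuclideanSpace.single i 1) = 0) :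
    ∃ c : ℝ, ∀ᵐ x ∂(volume : Measure (Vec n)), h x = c := by
  -- Mollifiers with radii `1/(k+1)` and `2/(k+1)`; the fixed ratio `2` is what almost everywhere
  -- convergence of the mollifications requires. Each mollification is constant, hence so is the
  -- limit.
  let b : ℕ → ContDiffBump (0 : Vec n) := fun k =>
    ⟨((k : ℝ) + 1)⁻¹, 2 * ((k : ℝ) + 1)⁻¹, by positivity, by
      have : 0 < ((k : ℝ) + 1)⁻¹ := by positivity
      linarith⟩
  have hlim := ContDiffBump.ae_convolution_tendsto_right_of_locallyIntegrable
    (φ := b) (l := atTop) (K := 2) (μ := (volume : Measure (Vec n))) (g := h) (by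
      have := (tendsto_one_div_add_atTop_nhds_zero_nat (𝕜 := ℝ)).const_mul 2
      simpa [b] using this) (Eventually.of_forall fun k => le_rfl) hloc
  let L := (ContinuousLinearMap.lsmul ℝ ℝ : ℝ →L[ℝ] ℝ →L[ℝ] ℝ)
  have hconst : ∀ k x y, (((b k).normed volume) ⋆[L, volume] h) x =
      (((b k).normed volume) ⋆[L, volume] h) y := by
    intro k
    set f := (b k).normed (volume : Measure (Vec n)) with hf
    have hfc : ContDiff ℝ ∞ f := (b k).contDiff_normed
    have hfs : HasCompactSupport f := (b k).hasCompactSupport_normed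
    -- The flip puts the smooth kernel on the right, so the derivative falls on it; its value at `x`
    -- is, in each coordinate direction, `H` for the test function `t ↦ f (x - t)` up to sign.
    rw [← convolution_flip]
    have hd := hfs.hasFDerivAt_convolution_right L.flip hloc (hfc.of_le (by simp))
    refine is_const_of_fderiv_eq_zero (𝕜 := ℝ) (fun x => (hd x).differentiableAt) fun x => ?_
    rw [(hd x).fderiv]
    have hbasis : ∀ i, ((h ⋆[L.flip.precompR (Vec n), volume] fderiv ℝ f) x)
        (EuclideanSpace.single i 1) = 0 := by
      intro i
      rw [convolution_precompR_apply L.flip hloc (hfs.fderiv ℝ) (hfc.continuous_fderiv (by simp)),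
        convolution_def]
      have hφ : ContDiff ℝ ∞ fun t => f (x - t) := hfc.comp (contDiff_const.sub contDiff_id)
      have hφs : HasCompactSupport fun t => f (x - t) :=
        hfs.comp_homeomorph (Homeomorph.subLeft x)
      have h0 := H _ hφ hφs i
      have hfd : ∀ t, fderiv ℝ (fun t => f (x - t)) t (EuclideanSpace.single i 1) =
          - fderiv ℝ f (x - t) (EuclideanSpace.single i 1) := by
        intro t
        have := (((hfc.differentiable (by simp) (x - t)).hasFDerivAt).comp t
          ((hasFDerivAt_id t).const_sub x)).fderiv
        simp only [Function.comp_def] at this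
        erw [this]
        simp
      simp only [hfd, mul_neg, integral_neg, neg_eq_zero] at h0
      rw [← h0]
      congr 1 with t
      simp [L, mul_comm]
    ext v
    rw [← (EuclideanSpace.basisFun (Fin n) ℝ).sum_repr v]
    simp [hbasis]
  obtain ⟨x₀, hx₀⟩ := hlim.exists
  refine ⟨h x₀, ?_⟩
  filter_upwards [hlim] with x hx
  refine tendsto_nhds_unique hx (hx₀.congr fun k => ?_)
  exact hconst k x₀ x

/-- Such a `u` is constant, and a nonzero constant is not in `L^{2*}` of a space of infinite
measure. -/
lemma eq_zero_of_isWeakGradient_zero (hn : 3 ≤ n)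
    {u : Lp (Vec N) (sobolevExp n) (volume : Measure (Vec n))}
    (h : IsWeakGradient u (0 : Vec n → Mat N n)) : u = 0 := by
  have hc : ∀ a, ∃ c : ℝ, ∀ᵐ x ∂(volume : Measure (Vec n)), u x a = c := fun a =>
    exists_ae_eq_const_of_integral_partial_eq_zero (locallyIntegrable_coord h.locallyIntegrable a)
      fun φ hφ hs i => by simpa using h.integral_eq φ hφ hs a i
  choose c hc using hc
  have hu : u =ᵐ[volume] fun _ => (WithLp.toLp 2 c : Vec N) := by
    filter_upwards [ae_all_iff.2 hc] with x hx
    ext a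
    exact hx a
  have hm := (memLp_congr_ae hu).1 (Lp.memLp u)
  have : Nonempty (Fin n) := Fin.pos_iff_nonempty.1 (by omega)
  rw [memLp_const_iff (by
    have := one_le_sobolevExp hn
    exact (zero_lt_one.trans_le this).ne') sobolevExp_ne_top] at hm
  have huniv : (volume : Measure (Vec n)) Set.univ = ⊤ :=
    measure_univ_of_isAddLeftInvariant _
  have hc0 : (WithLp.toLp 2 c : Vec N) = 0 := hm.resolve_right (by simp [huniv])
  refine Lp.ext (hu.trans ?_)
  rw [hc0]
  exact (Lp.coeFn_zero _ _ _).symm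

end

end FirstOrderSystem

end

/-! ### The nonlinear system: nearness to `A : D`, stability and existence. -/

noncomputable section
namespace FirstOrderSystem
open Filter Topology

section

variable {n N : ℕ}

/-- For a simple `G` the composition is a finite sum of the measurable `F(·, y)` cut to the fibres;
continuity in the second variable passes to pointwise limits of simple functions. -/
lemma IsCaratheodory.aestronglyMeasurable_comp {F : Vec n → Mat N n → Vec N}
    (hF : IsCaratheodory F) {G : Vec n → Mat N n} (hG : AEStronglyMeasurable G volume) :
    AEStronglyMeasurable (fun x => F x (G x)) volume := by
  have hsimple : ∀ s : SimpleFunc (Vec n) (Mat N n), AEMeasurable (fun x => F x (s x)) volume := by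
    intro s
    have : (fun x => F x (s x)) =
        fun x => ∑ y ∈ s.range, (s ⁻¹' {y}).indicator (fun x => F x y) x := by
      ext1 x
      rw [Finset.sum_eq_single (s x)]
      · simp
      · intro y _ hy
        exact Set.indicator_of_notMem (by simpa using hy.symm) _
      · intro h
        exact absurd (s.mem_range_self x) h
    rw [this]
    exact Finset.aemeasurable_fun_sum _ fun y _ =>
      (hF.aemeasurable y).indicator (s.measurableSet_fiber y)
  have hG' := hG.stronglyMeasurable_mk
  refine (aemeasurable_of_tendsto_metrizable_ae atTop
    (fun k => hsimple (hG'.approx k)) ?_).aestronglyMeasurable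
  filter_upwards [hG.ae_eq_mk, hF.ae_continuous] with x h1 h2
  rw [h1]
  exact (h2.tendsto _).comp (hG'.tendsto_approx x)

lemma Lp_norm_le_add {α E E₁ E₂ : Type*} [MeasurableSpace α] {μ : Measure α}
    [NormedAddCommGroup E] [NormedAddCommGroup E₁] [NormedAddCommGroup E₂]
    {f : Lp E 2 μ} {g : Lp E₁ 2 μ} {h : Lp E₂ 2 μ} {a b : ℝ} (ha : 0 ≤ a) (hb : 0 ≤ b)
    (H : ∀ᵐ x ∂μ, ‖f x‖ ≤ a * ‖g x‖ + b * ‖h x‖) : ‖f‖ ≤ a * ‖g‖ + b * ‖h‖ := by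
  have hg := (Lp.memLp g).norm
  have hh := (Lp.memLp h).norm
  have h1 : ‖f‖ ≤ ‖a • hg.toLp _ + b • hh.toLp _‖ := by
    refine Lp.norm_le_norm_of_ae_le ?_
    filter_upwards [H, Lp.coeFn_add (a • hg.toLp _) (b • hh.toLp _),
      Lp.coeFn_smul a (hg.toLp _), Lp.coeFn_smul b (hh.toLp _), hg.coeFn_toLp, hh.coeFn_toLp]
      with x h1 h2 h3 h4 h5 h6
    rw [h2, Pi.add_apply, h3, h4, Pi.smul_apply, Pi.smul_apply, h5, h6]
    exact h1.trans (le_abs_self _)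
  refine h1.trans ((norm_add_le _ _).trans_eq ?_)
  rw [norm_smul, norm_smul, Real.norm_of_nonneg ha, Real.norm_of_nonneg hb, Lp.norm_toLp,
    Lp.norm_toLp, eLpNorm_norm, eLpNorm_norm, Lp.norm_def, Lp.norm_def]

lemma IsWeakGradient.sub {u v : Vec n → Vec N} {G H : Vec n → Mat N n}
    (hu : IsWeakGradient u G) (hv : IsWeakGradient v H) : IsWeakGradient (u - v) (G - H) := by
  simpa [sub_eq_add_neg] using hu.add (hv.smul (-1))

lemma IsWeakGradient.sub_Lp {p : ℝ≥0∞} {u v : Lp (Vec N) p (volume : Measure (Vec n))}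
    {G H : Lp (Mat N n) 2 (volume : Measure (Vec n))}
    (hu : IsWeakGradient u G) (hv : IsWeakGradient v H) :
    IsWeakGradient (u - v : Lp (Vec N) p (volume : Measure (Vec n)))
      (G - H : Lp (Mat N n) 2 (volume : Measure (Vec n))) :=
  (hu.sub hv).congr (Lp.coeFn_sub _ _) (Lp.coeFn_sub _ _)

lemma grad_eq (u : lionsSpace n N) {G : Lp (Mat N n) 2 (volume : Measure (Vec n))}
    (h : IsWeakGradient (u : Lp (Vec N) (sobolevExp n) (volume : Measure (Vec n))) G) :
    grad u = G :=
  Lp.ext ((grad_spec u).ae_unique h)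

lemma grad_sub (u v : lionsSpace n N) : grad (u - v) = grad u - grad v :=
  grad_eq _ ((grad_spec u).sub_Lp (grad_spec v))

lemma grad_zero : grad (0 : lionsSpace n N) = 0 :=
  grad_eq _ (IsWeakGradient.zero.congr (Lp.coeFn_zero _ _ _) (Lp.coeFn_zero _ _ _))

/-- On the Lions space, the operator `u ↦ A : Du` is onto, and the Sobolev inequality holds. -/
theorem exists_grad_eq_and_sobolev (hn : 3 ≤ n) (hN : 0 < N) {A : Mat N n →ₗ[ℝ] Vec N}
    (hA : IsElliptic A) :
    (∀ f, ∃ u : lionsSpace n N, symbolOp A (grad u) = f) ∧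
    ∃ C : NNReal, ∀ u : lionsSpace n N,
      ‖(u : Lp (Vec N) (sobolevExp n) (volume : Measure (Vec n)))‖ ≤ C * ‖grad u‖ := by
  have : Fact (1 ≤ sobolevExp n) := ⟨one_le_sobolevExp hn⟩
  obtain ⟨C, hC⟩ := exists_symbolOp_eq hn hN hA
  refine ⟨fun f => ?_, C, fun u => ?_⟩
  · obtain ⟨u, G, h, hf, -⟩ := hC f
    exact ⟨⟨u, G, h⟩, by rw [grad_eq _ h, hf]⟩
  -- The solution `w` of `A : Dw = A : Du` satisfies Sobolev's inequality by construction. The a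
  -- priori estimate gives `D(u - w) = 0`, hence `u = w`: no density of test functions in the Lions
  -- space is needed.
  · obtain ⟨w, G, h, hf, hle⟩ := hC (symbolOp A (grad u))
    have hsub := (grad_spec u).sub_Lp h
    have h1 := ellipticityConst_mul_norm_grad_le (by omega) A hsub
    rw [map_sub, hf, sub_self, norm_zero] at h1
    have h2 : grad u - G = 0 := norm_eq_zero.1 (le_antisymm (nonpos_of_mul_nonpos_right h1
      (hA.ellipticityConst_pos (by omega) hN)) (norm_nonneg _))
    rw [h2] at hsub
    have h3 := eq_zero_of_isWeakGradient_zero hn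
      (hsub.congr EventuallyEq.rfl (Lp.coeFn_zero _ _ _).symm)
    rwa [sub_eq_zero.1 h3, sub_eq_zero.1 h2]

variable {F : Vec n → Mat N n → Vec N} {A : Mat N n →ₗ[ℝ] Vec N} {α : Vec n → ℝ} {β γ : ℝ}

lemma memLp_weighted_sub (hF : IsCaratheodory F) (hα : MemLp α ∞ volume)
    (hK : ∀ᵐ x ∂(volume : Measure (Vec n)), ∀ X Y : Mat N n,
      ‖α x • (F x (X + Y) - F x Y) - A X‖ ≤ β * ellipticityConst A * ‖X‖ + γ * ‖A X‖)
    (G H : Lp (Mat N n) 2 (volume : Measure (Vec n))) :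
    MemLp (fun x => α x • (F x (H x) - F x (G x))) 2 volume := by
  have hX := Lp.memLp (H - G)
  have hAX := Lp.memLp (symbolOp A (H - G))
  have hm : AEStronglyMeasurable (fun x => α x • (F x (H x) - F x (G x))) volume :=
    hα.1.smul ((hF.aestronglyMeasurable_comp (Lp.aestronglyMeasurable H)).sub
      (hF.aestronglyMeasurable_comp (Lp.aestronglyMeasurable G)))
  have h1 : MemLp (fun x => α x • (F x (H x) - F x (G x)) - symbolOp A (H - G) x) 2 volume := by
    refine MemLp.mono' ((hX.norm.const_mul (β * ellipticityConst A)).add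
      (hAX.norm.const_mul γ)) (hm.sub hAX.1) ?_
    filter_upwards [hK, Lp.coeFn_sub H G, symbolOp_ae A (H - G)] with x h1 h2 h3
    have := h1 ((H - G : Lp (Mat N n) 2 (volume : Measure (Vec n))) x) (G x)
    rw [h2, Pi.sub_apply, sub_add_cancel, ← Pi.sub_apply, ← h2] at this
    simpa only [Pi.add_apply, h3] using this
  refine (h1.add hAX).congr_norm hm (Eventually.of_forall fun x => ?_)
  simp only [Pi.add_apply, sub_add_cancel]

/-- The AK-condition in `L²`. The term with `ν(A) ‖D(v-u)‖` is absorbed by the a priori estimate,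
which holds for gradients but not for arbitrary matrix fields. -/
lemma norm_weighted_sub_symbolOp_le (hn : 0 < n) (hβ : 0 ≤ β) (hγ : 0 ≤ γ)
    (hK : ∀ᵐ x ∂(volume : Measure (Vec n)), ∀ X Y : Mat N n,
      ‖α x • (F x (X + Y) - F x Y) - A X‖ ≤ β * ellipticityConst A * ‖X‖ + γ * ‖A X‖)
    (u v : lionsSpace n N) {D : Lp (Vec N) 2 (volume : Measure (Vec n))}
    (hD : D =ᵐ[volume] fun x => α x • (F x (grad v x) - F x (grad u x))) :
    ‖D - symbolOp A (grad v - grad u)‖ ≤ (β + γ) * ‖symbolOp A (grad v - grad u)‖ := by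
  have hν := ellipticityConst_nonneg A
  have h1 : ‖D - symbolOp A (grad v - grad u)‖ ≤
      β * ellipticityConst A * ‖grad v - grad u‖ + γ * ‖symbolOp A (grad v - grad u)‖ := by
    refine Lp_norm_le_add (by positivity) hγ ?_
    filter_upwards [hK, Lp.coeFn_sub (grad v) (grad u), symbolOp_ae A (grad v - grad u), hD,
      Lp.coeFn_sub D (symbolOp A (grad v - grad u))] with x h1 h2 h3 h4 h5
    have := h1 ((grad v - grad u : Lp (Mat N n) 2 (volume : Measure (Vec n))) x) (grad u x)
    rw [h5, Pi.sub_apply, h3, h4]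
    rwa [h2, Pi.sub_apply, sub_add_cancel, ← Pi.sub_apply, ← h2] at this
  have h2 := ellipticityConst_mul_norm_grad_le hn A ((grad_spec v).sub_Lp (grad_spec u))
  have h3 := mul_le_mul_of_nonneg_left h2 hβ
  linarith

lemma memLp_sub (hF : IsCaratheodory F) (hpos : ∀ᵐ x ∂(volume : Measure (Vec n)), 0 < α x)
    (hα : MemLp α ∞ volume) (hα' : MemLp (fun x => 1 / α x) ∞ volume)
    (hK : ∀ᵐ x ∂(volume : Measure (Vec n)), ∀ X Y : Mat N n,
      ‖α x • (F x (X + Y) - F x Y) - A X‖ ≤ β * ellipticityConst A * ‖X‖ + γ * ‖A X‖)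
    (G H : Lp (Mat N n) 2 (volume : Measure (Vec n))) :
    MemLp (fun x => F x (H x) - F x (G x)) 2 volume := by
  have h : MemLp (fun x => (1 / α x) • (α x • (F x (H x) - F x (G x)))) 2 volume :=
    (memLp_weighted_sub hF hα hK G H).smul hα'
  refine (memLp_congr_ae ?_).1 h
  filter_upwards [hpos] with x hx
  rw [smul_smul, one_div, inv_mul_cancel₀ hx.ne', one_smul]

lemma exists_lionsNorm_sub_le (hn : 3 ≤ n) (hN : 0 < N) (hF : IsCaratheodory F)
    (hA : IsElliptic A) (hpos : ∀ᵐ x ∂(volume : Measure (Vec n)), 0 < α x)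
    (hα : MemLp α ∞ volume) (hα' : MemLp (fun x => 1 / α x) ∞ volume)
    (hβ : 0 < β) (hγ : 0 < γ) (hβγ : β + γ < 1)
    (hK : ∀ᵐ x ∂(volume : Measure (Vec n)), ∀ X Y : Mat N n,
      ‖α x • (F x (X + Y) - F x Y) - A X‖ ≤ β * ellipticityConst A * ‖X‖ + γ * ‖A X‖) :
    ∃ C : ℝ, 0 < C ∧ ∀ u v : lionsSpace n N, lionsNorm (v - u) ≤
      C * (eLpNorm (fun x => F x (grad v x) - F x (grad u x)) 2 volume).toReal := by
  have hn0 : 0 < n := by omega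
  have hν := hA.ellipticityConst_pos hn0 hN
  obtain ⟨C, hC⟩ := (exists_grad_eq_and_sobolev hn hN hA).2
  have hC0 : (0 : ℝ) ≤ C := C.2
  obtain ⟨M, hM0, hM⟩ : ∃ M : ℝ, 0 < M ∧ ∀ᵐ x ∂(volume : Measure (Vec n)), ‖α x‖ ≤ M := by
    refine ⟨(eLpNorm α ∞ volume).toReal + 1, by positivity, ?_⟩
    filter_upwards [enorm_ae_le_eLpNormEssSup α (volume : Measure (Vec n))] with x hx
    rw [← eLpNorm_exponent_top] at hx
    have := ENNReal.toReal_mono hα.2.ne hx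
    rw [toReal_enorm] at this
    linarith
  have hθ : 0 < 1 - (β + γ) := by linarith
  -- The factors come from Sobolev's inequality, the a priori estimate, the triangle inequality in
  -- the nearness bound, and the supremum of `α`.
  refine ⟨(C + 1) * ((ellipticityConst A)⁻¹ * ((1 - (β + γ))⁻¹ * M)), by positivity,
    fun u v => ?_⟩
  have hm := memLp_sub hF hpos hα hα' hK (grad u) (grad v)
  have hw := memLp_weighted_sub hF hα hK (grad u) (grad v)
  have h1 := norm_weighted_sub_symbolOp_le hn0 hβ.le hγ.le hK u v hw.coeFn_toLp
  have h2 : ‖hw.toLp _‖ ≤ M * ‖hm.toLp _‖ := by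
    refine Lp.norm_le_mul_norm_of_ae_le_mul ?_
    filter_upwards [hM, hw.coeFn_toLp, hm.coeFn_toLp] with x h1 h2 h3
    rw [h2, h3, norm_smul]
    gcongr
  have h3 := ellipticityConst_mul_norm_grad_le hn0 A ((grad_spec v).sub_Lp (grad_spec u))
  have h4 : ‖symbolOp A (grad v - grad u)‖ ≤ (1 - (β + γ))⁻¹ * (M * ‖hm.toLp _‖) := by
    rw [inv_mul_eq_div, le_div_iff₀ hθ]
    have := norm_sub_norm_le (symbolOp A (grad v - grad u)) (hw.toLp _)
    rw [norm_sub_rev] at this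
    linarith
  have h5 : ‖grad v - grad u‖ ≤ (ellipticityConst A)⁻¹ * ‖symbolOp A (grad v - grad u)‖ := by
    rw [inv_mul_eq_div, le_div_iff₀ hν, mul_comm]
    exact h3
  have h6 := hC (v - u)
  rw [← Lp.norm_toLp _ hm, lionsNorm]
  rw [grad_sub] at h6 ⊢
  calc _ ≤ (C + 1) * ‖grad v - grad u‖ := by linarith
    _ ≤ (C + 1) * ((ellipticityConst A)⁻¹ * ((1 - (β + γ))⁻¹ * (M * ‖hm.toLp _‖))) := by
        gcongr
        exact h5.trans (by gcongr)
    _ = _ := by ring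

lemma exists_isStrongSolution (hn : 3 ≤ n) (hN : 0 < N) (hF : IsCaratheodory F)
    (hA : IsElliptic A) (hpos : ∀ᵐ x ∂(volume : Measure (Vec n)), 0 < α x)
    (hα : MemLp α ∞ volume) (hβ : 0 < β) (hγ : 0 < γ) (hβγ : β + γ < 1)
    (hK : ∀ᵐ x ∂(volume : Measure (Vec n)), ∀ X Y : Mat N n,
      ‖α x • (F x (X + Y) - F x Y) - A X‖ ≤ β * ellipticityConst A * ‖X‖ + γ * ‖A X‖)
    (hF0 : ∀ᵐ x ∂(volume : Measure (Vec n)), F x 0 = 0)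
    (f : Lp (Vec N) 2 (volume : Measure (Vec n))) :
    ∃ u : lionsSpace n N, IsStrongSolution F f u := by
  have hn0 : 0 < n := by omega
  -- `U` is a right inverse of `u ↦ A : Du`; its linearity is never needed, since only `A : D(U g) =
  -- g` enters.
  choose U hU using (exists_grad_eq_and_sobolev hn hN hA).1
  have hw := fun g => memLp_weighted_sub hF hα hK 0 (grad (U g))
  have hαf : MemLp (fun x => α x • f x) 2 volume := (Lp.memLp f).smul hα
  -- `T g = g - α (F(·, D(U g)) - F(·, 0)) + α f`. As `g = A : D(U g)`, nearness makes `T` a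
  -- contraction with factor `β + γ`; since `F(·, 0) = 0` and `α > 0`, a fixed point gives `F(·, D(U
  -- g)) = f`.
  let T : Lp (Vec N) 2 (volume : Measure (Vec n)) → Lp (Vec N) 2 (volume : Measure (Vec n)) :=
    fun g => g - (hw g).toLp _ + hαf.toLp _
  have hT : ContractingWith (β + γ).toNNReal T := by
    refine ⟨by rw [← NNReal.coe_lt_coe, Real.coe_toNNReal _ (by linarith)]; simpa using hβγ,
      LipschitzWith.of_dist_le_mul fun g g' => ?_⟩
    rw [dist_eq_norm, dist_eq_norm, Real.coe_toNNReal _ (by linarith)]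
    have hD : ((hw g).toLp _ - (hw g').toLp _ : Lp (Vec N) 2 (volume : Measure (Vec n))) =ᵐ[volume]
        fun x => α x • (F x (grad (U g) x) - F x (grad (U g') x)) := by
      filter_upwards [Lp.coeFn_sub ((hw g).toLp _) ((hw g').toLp _), (hw g).coeFn_toLp,
        (hw g').coeFn_toLp] with x h1 h2 h3
      rw [h1, Pi.sub_apply, h2, h3, ← smul_sub, sub_sub_sub_cancel_right]
    have h := norm_weighted_sub_symbolOp_le hn0 hβ.le hγ.le hK (U g') (U g) hD
    rw [map_sub, hU, hU, norm_sub_rev] at h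
    refine le_of_eq_of_le ?_ h
    congr 1
    simp only [T]
    abel
  have hfix := hT.fixedPoint_isFixedPt
  set g := hT.fixedPoint T
  have heq : (hw g).toLp _ = hαf.toLp _ := by
    have h : g - (hw g).toLp _ + hαf.toLp _ = g := hfix
    rw [sub_add_eq_add_sub, sub_eq_iff_eq_add] at h
    exact (add_left_cancel h).symm
  refine ⟨U g, ?_⟩
  filter_upwards [(hw g).coeFn_toLp, hαf.coeFn_toLp, hpos, hF0,
    Lp.coeFn_zero (Mat N n) 2 (volume : Measure (Vec n))] with x h1 h2 h3 h4 h5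
  rw [heq, h2, h5, Pi.zero_apply, h4, sub_zero] at h1
  exact (smul_right_injective _ h3.ne' h1).symm

end

end FirstOrderSystem

end

open FirstOrderSystem
theorem theorem4p1 (n N : ℕ) (hn : 3 ≤ n) (hN : 2 ≤ N)
    (F : Vec n → Mat N n → Vec N) (hF : IsCaratheodory F)
    (hAK : ∃ A : Mat N n →ₗ[ℝ] Vec N, AKCondition F A) :
    ((∃ C : ℝ, 0 < C ∧ ∀ u v : lionsSpace n N,
        MemLp (fun x => F x (grad v x) - F x (grad u x)) 2 volume ∧
        lionsNorm (v - u) ≤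
          C * (eLpNorm (fun x => F x (grad v x) - F x (grad u x)) 2 volume).toReal) ∧
      (∀ (f : Vec n → Vec N) (u v : lionsSpace n N),
        IsStrongSolution F f u → IsStrongSolution F f v → u = v)) ∧
    ((∀ᵐ x ∂(volume : Measure (Vec n)), F x 0 = 0) →
      ∃ C : ℝ, 0 < C ∧ ∀ f : Lp (Vec N) 2 (volume : Measure (Vec n)),
        ∃ u : lionsSpace n N,
          IsStrongSolution F f u ∧
          (∀ v : lionsSpace n N, IsStrongSolution F f v → v = u) ∧
          lionsNorm u ≤ C * ‖f‖) := by
  obtain ⟨A, hA, α, β, γ, hpos, hα, hα', hβ, hγ, hβγ, hK⟩ := hAK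
  have hN0 : 0 < N := by omega
  obtain ⟨C, hC0, hC⟩ := exists_lionsNorm_sub_le hn hN0 hF hA hpos hα hα' hβ hγ hβγ hK
  have huniq : ∀ (f : Vec n → Vec N) (u v : lionsSpace n N),
      IsStrongSolution F f u → IsStrongSolution F f v → u = v := by
    intro f u v hu hv
    have h := hC v u
    have h0 : (fun x => F x (grad u x) - F x (grad v x)) =ᵐ[volume] 0 := by
      filter_upwards [hu, hv] with x h1 h2
      simp [h1, h2]
    rw [eLpNorm_congr_ae h0, eLpNorm_zero, ENNReal.toReal_zero, mul_zero, lionsNorm] at h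
    have : Fact (1 ≤ sobolevExp n) := ⟨one_le_sobolevExp hn⟩
    have h1 := norm_nonneg ((u - v : lionsSpace n N) : Lp (Vec N) (sobolevExp n)
      (volume : Measure (Vec n)))
    have h2 := norm_nonneg (grad (u - v))
    have h3 := norm_eq_zero.1 (le_antisymm (by linarith) h1)
    exact sub_eq_zero.1 (Subtype.ext h3)
  refine ⟨⟨⟨C, hC0, fun u v => ⟨memLp_sub hF hpos hα hα' hK _ _, hC u v⟩⟩, huniq⟩, fun hF0 =>
    ⟨C, hC0, fun f => ?_⟩⟩
  obtain ⟨u, hu⟩ := exists_isStrongSolution hn hN0 hF hA hpos hα hβ hγ hβγ hK hF0 f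
  refine ⟨u, hu, fun v hv => huniq _ _ _ hv hu, ?_⟩
  -- Comparison with the zero map, for which `F(·, 0) = 0`, turns stability into the bound by `‖f‖`.
  have h := hC 0 u
  have h0 : (fun x => F x (grad u x) - F x (grad (0 : lionsSpace n N) x)) =ᵐ[volume] f := by
    rw [grad_zero]
    filter_upwards [hu, hF0, Lp.coeFn_zero (Mat N n) 2 (volume : Measure (Vec n))] with x h1 h2 h3
    rw [h1, h3, Pi.zero_apply, h2, sub_zero]
  rwa [eLpNorm_congr_ae h0, sub_zero, ← Lp.norm_def] at h
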